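/- Let $d\ge 1$, let $\mathbb N=\{1,2,\dots\}$, and let $\{\xi_m,\ m\in\mathbb N^d\}$ be independent copies of an integrable real random variable $\xi$ with mean $\mu=\mathbf E\,\xi>0$. For $n\in\{0,1,2,\dots\}^d$ put $S_n=\sum_{m\in\mathbb N^d,\ m\le n}\xi_m$ (componentwise order), so that $S_n=0$ if some component of $n$ vanishes. Extend $S$ to $\mathbb R_+^d=[0,\infty)^d$ by piecewise multilinear interpolation: $S_x=\sum_{k\in C_x}v_k(x)S_{k^*}$, where $C_x$ is the set of vertices of a unit lattice cube in $\mathbb R_+^d$ containing $x$, $v_k(x)=\prod_{i=1}^d|x^i-k^i|$, and $k^*$ is the vertex of that cube opposite to $k$. For $t>0$ and $c\in\mathbb R$ let $$M_t=\{x\in\mathbb R_+^d:\ S_x\ge t\},\qquad H(c)=\{x\in\mathbb R_+^d:\ x^1\cdots x^d\ge\mu^{-1}+c\}.$$ Write $\log$ for the natural logarithm modified to equal $1$ on $[0,e)$. If $$\mathbf E\bigl(|\xi|^\beta\log^{d-1}|\xi|\bigr)<\infty\quad\text{for some }\beta\in[1,2),$$ then, for each $\varepsilon>0$, almost surely there is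 a (random) $T<\infty$ such that for all $t\ge T$ $$H(\varepsilon t^{-1+1/\beta})\subset t^{-1/d}M_t\subset H(-\varepsilon t^{-1+1/\beta}).$$ -/

import Mathlib

open MeasureTheory ProbabilityTheory Filter
open scoped Pointwise

noncomputable section

namespace RenewalSets

/-- The logarithm on `[0, ∞)`, modified to equal `1` on `[0, e)`. -/
def logE (c : ℝ) : ℝ := if c < Real.exp 1 then 1 else Real.log c

/-- The multiple sum `S_n`, `n ∈ ℤ₊^d`, of the array `a` indexed by positive multi-indices:
the sum of `a m` over all `m ≤ n` (componentwise), and `0` if some component of `n` vanishes. -/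
def multiSum {d : ℕ} (a : (Fin d → ℕ+) → ℝ) (n : Fin d → ℕ) : ℝ :=
  if h : ∀ i, 0 < n i then ∑ m ∈ Finset.Iic (fun i => (n i).toPNat (h i)), a m else 0

/-- The lower corner of a unit lattice cube of `ℝ₊^d` that contains `x`. -/
def lowerCorner {d : ℕ} (x : Fin d → ℝ) : Fin d → ℕ := fun i => ⌊x i⌋₊

/-- The set `C_x` of the vertices of the unit lattice cube with the corner `lowerCorner x`. -/
def cubeVertices {d : ℕ} (x : Fin d → ℝ) : Finset (Fin d → ℕ) :=
  Finset.Icc (lowerCorner x) (lowerCorner x + 1)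

/-- The vertex `k*` of that cube that is opposite to its vertex `k`. -/
def oppositeVertex {d : ℕ} (x : Fin d → ℝ) (k : Fin d → ℕ) : Fin d → ℕ :=
  fun i => 2 * lowerCorner x i + 1 - k i

/-- The volume `v_k(x)` of the box with diagonally opposite vertices `k` and `x` and with faces
parallel to the coordinate planes. -/
def boxVolume {d : ℕ} (x : Fin d → ℝ) (k : Fin d → ℕ) : ℝ := ∏ i, |x i - (k i : ℝ)|

/-- The piecewise multilinear interpolation `S_x`, `x ∈ ℝ₊^d`, of the multiple sums. -/
def interpSum {d : ℕ} (a : (Fin d → ℕ+) → ℝ) (x : Fin d → ℝ) : ℝ :=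
  ∑ k ∈ cubeVertices x, boxVolume x k * multiSum a (oppositeVertex x k)

/-- The renewal set `M_t`: all `x ∈ ℝ₊^d` with `S_x ≥ t`. -/
def renewalSet {d : ℕ} (a : (Fin d → ℕ+) → ℝ) (t : ℝ) : Set (Fin d → ℝ) :=
  {x | 0 ≤ x ∧ t ≤ interpSum a x}

/-- The set `H(c)`: all `x ∈ ℝ₊^d` with `x¹ ⋯ x^d ≥ μ⁻¹ + c`. -/
def hypSet (d : ℕ) (μ c : ℝ) : Set (Fin d → ℝ) :=
  {x | 0 ≤ x ∧ μ⁻¹ + c ≤ ∏ i, x i}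

end RenewalSets

end

/-! Write |n| for the product of the components of n. The probabilistic core is a
Marcinkiewicz-Zygmund law, `ae_exists_abs_sum_indexBox_sub_le`: for each δ > 0, almost surely |S_n -
μ|n|| ≤ δ|n|^(1/β) + C for all n at once, with a random C. The constant absorbs finitely many
exceptional indices or blocks, so no limit over multi-indices is needed.

To prove it, take b = 2^(1/β) and truncate the summand at m at level b^k, where k = `dyadicOrder m`,
so that the level is comparable to |m|^(1/β). At most (k+1)^(d-1) 2^k indices have order k
(`tsum_dyadicOrder_le`); this count is where the factor log^(d-1) in the moment condition comes
from. Three errors remain: the removed large values (Borel-Cantelli), the shift of the means (a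
Kronecker or Cesàro argument), and the centred truncated sums. The last are controlled on dyadic
blocks by an L² maximal inequality with constant 4^d (`integral_sq_norm_boxSum_le`), Chebyshev and
Borel-Cantelli.

The rest is deterministic. Multilinear interpolation reproduces |x| and, by concavity, does not
increase |x|^(1/β), so the bound passes to all real x (`abs_interpSum_sub_le`). After scaling by
t^(1/d) the error is a small multiple of t^(1/β) near the boundary of H, while shifting H by ε
t^(-1+1/β) moves μt|x| by με t^(1/β) (`eventually_hypSet_subset_smul_renewalSet`). -/

/-! ### Doob's L² maximal inequality for vector-valued sums. -/

theorem sq_partialSups_add_le (s : ℕ → ℝ) (n : ℕ) :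
    partialSups s n ^ 2 + 4 * ∑ i ∈ Finset.range n, partialSups s i * (s (i + 1) - s i) ≤
      4 * s n ^ 2 := by
  -- Discrete analogue of ∫ M dM = M²/2: a new record contributes the slack (s (n+1) - M)²/2, and
  -- otherwise nothing is lost. The claim then follows from 4 M s ≤ M² + 4 s².
  have key : partialSups s n ^ 2 / 2 +
      ∑ i ∈ Finset.range n, partialSups s i * (s (i + 1) - s i) ≤ partialSups s n * s n := by
    induction n with
    | zero => simp; nlinarith [sq_nonneg (s 0)]
    | succ n ih =>
      rw [Finset.sum_range_succ, partialSups_add_one]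
      rcases le_total (partialSups s n) (s (n + 1)) with h | h
      · rw [sup_eq_right.2 h]
        nlinarith [sq_nonneg (s (n + 1) - partialSups s n)]
      · rw [sup_eq_left.2 h]
        nlinarith
  nlinarith [sq_nonneg (partialSups s n - 2 * s n)]

section Doob

variable {Ω : Type*} {mΩ : MeasurableSpace Ω} {P : Measure Ω} [IsProbabilityMeasure P]
  {E : Type*} [NormedAddCommGroup E] [NormedSpace ℝ E] [CompleteSpace E] [MeasurableSpace E]
  [BorelSpace E] [SecondCountableTopology E]

/-- The submartingale property of the norm, tested against M. By Fubini on the product law of (M, S)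
and R, it reduces to ‖s‖ = ‖E(s + R)‖ ≤ E‖s + R‖ for fixed s, so conditional expectations are not
needed. -/
theorem integral_mul_norm_add_sub_norm_nonneg {M : Ω → ℝ} {S R : Ω → E} (hM : MemLp M 2 P)
    (hM0 : ∀ ω, 0 ≤ M ω) (hMm : Measurable M) (hSm : Measurable S) (hRm : Measurable R)
    (hR : MemLp R 2 P) (hR0 : ∫ ω, R ω ∂P = 0)
    (hind : IndepFun (fun ω => (M ω, S ω)) R P) :
    0 ≤ ∫ ω, M ω * (‖S ω + R ω‖ - ‖S ω‖) ∂P := by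
  have hW : Measurable (fun ω => (M ω, S ω)) := hMm.prodMk hSm
  have hlaw := (indepFun_iff_map_prod_eq_prod_map_map hW.aemeasurable hRm.aemeasurable).1 hind
  let g : (ℝ × E) × E → ℝ := fun p => p.1.1 * (‖p.1.2 + p.2‖ - ‖p.1.2‖)
  have hg : Measurable g := by fun_prop
  have hpair : Measurable (fun ω => ((M ω, S ω), R ω)) := hW.prodMk hRm
  have hRint : Integrable R P := hR.integrable (by norm_num)
  have hint : Integrable (fun ω => g ((M ω, S ω), R ω)) P := by
    refine (hM.integrable_mul hR.norm).mono (hg.comp hpair).aestronglyMeasurable ?_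
    filter_upwards with ω
    simp only [g, norm_mul, Pi.mul_apply, norm_norm]
    gcongr
    simpa using abs_norm_sub_norm_le (S ω + R ω) (S ω)
  have hint' : Integrable g ((P.map fun ω => (M ω, S ω)).prod (P.map R)) := by
    rw [← hlaw]
    exact (integrable_map_measure hg.aestronglyMeasurable hpair.aemeasurable).2 hint
  have : IsProbabilityMeasure (P.map R) := Measure.isProbabilityMeasure_map hRm.aemeasurable
  have e : ∫ ω, g ((M ω, S ω), R ω) ∂P =
      ∫ p, g p ∂((P.map fun ω => (M ω, S ω)).prod (P.map R)) := by
    rw [← hlaw, integral_map hpair.aemeasurable hg.aestronglyMeasurable]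
  change 0 ≤ ∫ ω, g ((M ω, S ω), R ω) ∂P
  rw [e, integral_prod _ hint', integral_map hW.aemeasurable]
  · refine integral_nonneg fun ω => ?_
    have hid : Integrable (fun r : E => r) (P.map R) :=
      (integrable_map_measure aestronglyMeasurable_id hRm.aemeasurable).2 hRint
    have hz : ∫ r, r ∂(P.map R) = 0 := by
      rw [integral_map (f := fun r : E => r) hRm.aemeasurable aestronglyMeasurable_id, hR0]
    simp only [g, integral_const_mul]
    refine mul_nonneg (hM0 ω) ?_
    have hadd : Integrable (fun r => S ω + r) (P.map R) := (integrable_const _).add hid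
    rw [integral_sub hadd.norm (integrable_const _)]
    have h1 := norm_integral_le_integral_norm (μ := P.map R) (fun r => S ω + r)
    rw [integral_add (integrable_const _) hid, hz] at h1
    simpa using h1
  · exact (hg.stronglyMeasurable.integral_prod_right').aestronglyMeasurable

/-- Doob's maximal inequality in `L²` for the norms of the partial sums of a sequence of centred
random vectors, each independent of the past. -/
theorem integral_sq_partialSups_norm_sum_le {R : ℕ → Ω → E} (hRm : ∀ i, Measurable (R i))
    (hR : ∀ i, MemLp (R i) 2 P) (hR0 : ∀ i, ∫ ω, R i ω ∂P = 0)
    (F : ℕ → MeasurableSpace Ω) (hF : Monotone F)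
    (hRF : ∀ i, Measurable[F (i + 1)] (R i))
    (hind : ∀ i, Indep (F i) (MeasurableSpace.comap (R i) inferInstance) P) (n : ℕ) :
    Integrable (fun ω => partialSups (fun k => ‖∑ i ∈ Finset.range k, R i ω‖) n ^ 2) P ∧
    ∫ ω, partialSups (fun k => ‖∑ i ∈ Finset.range k, R i ω‖) n ^ 2 ∂P ≤
      4 * ∫ ω, ‖∑ i ∈ Finset.range n, R i ω‖ ^ 2 ∂P := by
  let S : ℕ → Ω → E := fun k ω => ∑ i ∈ Finset.range k, R i ω
  let M : ℕ → Ω → ℝ := fun k ω => partialSups (fun k => ‖S k ω‖) k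
  have hS2 : ∀ k, MemLp (S k) 2 P := fun k => memLp_finsetSum _ fun i _ => hR i
  have hSm : ∀ k, Measurable (S k) := fun k => Finset.measurable_fun_sum _ fun i _ => hRm i
  have hM1 : ∀ k, M (k + 1) = M k ⊔ fun ω => ‖S (k + 1) ω‖ := fun k => by
    ext ω; simp [M, partialSups_add_one]
  have hM2 : ∀ k, MemLp (M k) 2 P := by
    intro k
    induction k with
    | zero => simpa [M] using (hS2 0).norm
    | succ k ih => rw [hM1]; exact ih.sup (hS2 _).norm
  have hM0 : ∀ k ω, 0 ≤ M k ω := fun k ω =>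
    (norm_nonneg _).trans (le_partialSups (fun k => ‖S k ω‖) k)
  have hSF : ∀ k, Measurable[F k] (S k) := fun k =>
    Finset.measurable_fun_sum _ fun i hi => (hRF i).mono (hF (Finset.mem_range.1 hi)) le_rfl
  have hMF : ∀ k, Measurable[F k] (M k) := by
    intro k
    induction k with
    | zero => simpa [M, Function.comp_def] using measurable_norm.comp (hSF 0)
    | succ k ih =>
      rw [hM1]
      exact measurable_sup.comp ((ih.mono (hF k.le_succ) le_rfl).prodMk
        (measurable_norm.comp (hSF (k + 1))))
  have hMm : ∀ k, Measurable (M k) := by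
    intro k
    induction k with
    | zero => simpa [M] using (hSm 0).norm
    | succ k ih => rw [hM1]; exact ih.sup (hSm (k + 1)).norm
  have hstep : ∀ k, 0 ≤ ∫ ω, M k ω * (‖S (k + 1) ω‖ - ‖S k ω‖) ∂P := by
    intro k
    have hi : IndepFun (fun ω => (M k ω, S k ω)) (R k) P :=
      indep_of_indep_of_le_left (hind k) ((hMF k).prodMk (hSF k)).comap_le
    have := integral_mul_norm_add_sub_norm_nonneg (hM2 k) (hM0 k) (hMm k) (hSm k) (hRm k) (hR k)
      (hR0 k) hi
    simpa [S, Finset.sum_range_succ] using this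
  have hstepi : ∀ k, Integrable (fun ω => M k ω * (‖S (k + 1) ω‖ - ‖S k ω‖)) P := fun k =>
    (hM2 k).integrable_mul ((hS2 (k + 1)).norm.sub (hS2 k).norm)
  have hMi := (hM2 n).integrable_sq
  refine ⟨hMi, ?_⟩
  have hsum : Integrable (fun ω => ∑ k ∈ Finset.range n, M k ω * (‖S (k + 1) ω‖ - ‖S k ω‖)) P :=
    integrable_finsetSum _ fun k _ => hstepi k
  have hle : ∫ ω, (M n ω ^ 2 + 4 * ∑ k ∈ Finset.range n, M k ω * (‖S (k + 1) ω‖ - ‖S k ω‖)) ∂P ≤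
      ∫ ω, 4 * ‖S n ω‖ ^ 2 ∂P :=
    integral_mono (hMi.add (hsum.const_mul 4)) ((hS2 n).norm.integrable_sq.const_mul 4)
      fun ω => sq_partialSups_add_le (fun k => ‖S k ω‖) n
  rw [integral_add hMi (hsum.const_mul 4), integral_const_mul, integral_const_mul,
    integral_finsetSum _ fun k _ => hstepi k] at hle
  have := Finset.sum_nonneg fun k (_ : k ∈ Finset.range n) => hstep k
  change ∫ ω, M n ω ^ 2 ∂P ≤ 4 * ∫ ω, ‖S n ω‖ ^ 2 ∂P
  linarith

end Doob

/-! ### The maximal inequality over boxes of multi-indices. -/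

section MultiIndex

variable {Ω : Type*} {mΩ : MeasurableSpace Ω} {P : Measure Ω} [IsProbabilityMeasure P]
  {ι : Type*} {X : ι → Ω → ℝ}

theorem integral_sq_sum_eq_of_iIndepFun (hX2 : ∀ a, MemLp (X a) 2 P)
    (hX0 : ∀ a, ∫ ω, X a ω ∂P = 0) (hX : iIndepFun X P) (I : Finset ι) :
    ∫ ω, (∑ a ∈ I, X a ω) ^ 2 ∂P = ∑ a ∈ I, ∫ ω, X a ω ^ 2 ∂P := by
  have hv : ∀ Y : Ω → ℝ, MemLp Y 2 P → ∫ ω, Y ω ∂P = 0 → ∫ ω, Y ω ^ 2 ∂P = variance Y P :=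
    fun Y hY h0 => (variance_of_integral_eq_zero hY.aemeasurable h0).symm
  have h := IndepFun.variance_sum (μ := P) (X := X) (s := I) (fun a _ => hX2 a)
    (fun a _ b _ hab => hX.indepFun hab)
  have hs2 : MemLp (∑ a ∈ I, X a) 2 P := memLp_finsetSum' _ fun a _ => hX2 a
  have hs0 : ∫ ω, (∑ a ∈ I, X a) ω ∂P = 0 := by
    simp only [Finset.sum_apply]
    rw [integral_finsetSum _ fun a _ => (hX2 a).integrable (by norm_num)]
    simp [hX0]
  rw [← hv _ hs2 hs0] at h
  simp only [Finset.sum_apply] at h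
  rw [h]
  exact Finset.sum_congr rfl fun a _ => (hv _ (hX2 a) (hX0 a)).symm

/-- The maximal inequality in `L²` for sums of independent centred random variables over the
lower sets of a multi-indexed family. -/
theorem integral_sq_norm_boxSum_le (hXm : ∀ a, Measurable (X a))
    (hX2 : ∀ a, MemLp (X a) 2 P) (hX0 : ∀ a, ∫ ω, X a ω ∂P = 0) (hX : iIndepFun X P) (K : ℕ)
    {d : ℕ} (c : ι → Fin d → ℕ) (I : Finset ι) :
    ∫ ω, ‖fun n : Fin d → Fin K => ∑ a ∈ I with ∀ i, c a i < n i, X a ω‖ ^ 2 ∂P ≤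
      4 ^ d * ∑ a ∈ I, ∫ ω, X a ω ^ 2 ∂P := by
  induction d generalizing I with
  | zero =>
    refine le_of_eq ?_
    rw [pow_zero, one_mul, ← integral_sq_sum_eq_of_iIndepFun hX2 hX0 hX]
    congr 1 with ω
    have : (fun n : Fin 0 → Fin K => ∑ a ∈ I with ∀ i, c a i < n i, X a ω) =
        fun _ => ∑ a ∈ I, X a ω := by
      ext n; simp
    rw [this, pi_norm_const, Real.norm_eq_abs, sq_abs]
  | succ d ih =>
    classical
    -- The slice with first coordinate j, recorded as the vector of all its box sums in the
    -- remaining coordinates. Under the sup norm, Doob's inequality along j handles the first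
    -- coordinate at the cost of a factor 4; the vector at the final time is again a family of box
    -- sums with one coordinate fewer, and the induction hypothesis applies.
    let R : ℕ → Ω → (Fin d → Fin K) → ℝ := fun j ω n =>
      ∑ a ∈ I with c a 0 = j ∧ ∀ i : Fin d, c a i.succ < n i, X a ω
    have hRm : ∀ j, Measurable (R j) := fun j => measurable_pi_lambda _ fun n =>
      Finset.measurable_fun_sum _ fun a _ => hXm a
    have hR2 : ∀ j, MemLp (R j) 2 P := fun j => by
      rw [memLp_pi_iff]
      exact fun n => memLp_finsetSum _ fun a _ => hX2 a
    have hR0 : ∀ j, ∫ ω, R j ω ∂P = 0 := fun j => by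
      ext n
      rw [eval_integral]
      · simp only [R]
        rw [integral_finsetSum _ fun a _ => (hX2 a).integrable (by norm_num)]
        simp [hX0]
      · exact fun n => (memLp_finsetSum _ fun a _ => hX2 a).integrable (by norm_num)
    let G : Set ι → MeasurableSpace Ω := fun A =>
      ⨆ a ∈ A, MeasurableSpace.comap (X a) inferInstance
    have hG : ∀ {A : Set ι} {a}, a ∈ A → Measurable[G A] (X a) := fun {A a} ha =>
      (comap_measurable (X a)).mono (le_biSup (fun a => MeasurableSpace.comap (X a) _) ha) le_rfl
    have hGm : Monotone G := fun A B h => biSup_mono h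
    have hRG : ∀ j, Measurable[G {a | c a 0 = j}] (R j) := fun j =>
      @measurable_pi_lambda _ _ _ (G _) _ _ fun n => Finset.measurable_fun_sum _ fun a ha =>
        hG (Finset.mem_filter.1 ha).2.1
    have hF : Monotone fun j => G {a | c a 0 < j} := fun j k hjk =>
      hGm fun a (ha : c a 0 < j) => ha.trans_le hjk
    have hind : ∀ j, Indep (G {a | c a 0 < j})
        (MeasurableSpace.comap (R j) inferInstance) P := fun j => by
      refine indep_of_indep_of_le_right (m₂ := G {a | c a 0 = j}) ?_ (hRG j).comap_le
      refine indep_iSup_of_disjoint (fun a => (hXm a).comap_le) hX.iIndep ?_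
      rw [Set.disjoint_left]
      intro a (h1 : c a 0 < j) (h2 : c a 0 = j)
      omega
    obtain ⟨hint, hle⟩ := integral_sq_partialSups_norm_sum_le hRm hR2 hR0
      (fun j => G {a | c a 0 < j}) hF
      (fun j => (hRG j).mono (hGm fun a (ha : _ = _) => by simp [ha]) le_rfl) hind K
    have hsum : ∀ k ω (n : Fin d → Fin K), (∑ j ∈ Finset.range k, R j ω) n =
        ∑ a ∈ I with c a 0 < k ∧ ∀ i : Fin d, c a i.succ < n i, X a ω := by
      intro k ω n
      rw [Finset.sum_apply]
      have : ∀ j ∈ Finset.range k, R j ω n = ∑ a ∈ {a ∈ I | c a 0 < k ∧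
          ∀ i : Fin d, c a i.succ < n i} with c a 0 = j, X a ω := by
        intro j hj
        rw [Finset.filter_filter]
        refine Finset.sum_congr (Finset.filter_congr fun a _ => ?_) fun _ _ => rfl
        have := Finset.mem_range.1 hj
        constructor
        · rintro ⟨h1, h2⟩; exact ⟨⟨by omega, h2⟩, h1⟩
        · rintro ⟨⟨_, h2⟩, h1⟩; exact ⟨h1, h2⟩
      rw [Finset.sum_congr rfl this]
      exact Finset.sum_fiberwise_of_maps_to
        (fun a ha => Finset.mem_range.2 (Finset.mem_filter.1 ha).2.1) _
    calc ∫ ω, ‖fun n : Fin (d + 1) → Fin K => ∑ a ∈ I with ∀ i, c a i < n i, X a ω‖ ^ 2 ∂P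
        ≤ ∫ ω, partialSups (fun k => ‖∑ i ∈ Finset.range k, R i ω‖) K ^ 2 ∂P := by
          refine integral_mono_of_nonneg (.of_forall fun ω => by positivity) hint
            (.of_forall fun ω => ?_)
          have h0 : 0 ≤ partialSups (fun k => ‖∑ i ∈ Finset.range k, R i ω‖) K :=
            (norm_nonneg _).trans (le_partialSups (fun k => ‖∑ i ∈ Finset.range k, R i ω‖) K)
          refine pow_le_pow_left₀ (norm_nonneg _) ((pi_norm_le_iff_of_nonneg h0).2 fun n => ?_) 2
          refine le_trans ?_ (le_partialSups_of_le (fun k => ‖∑ i ∈ Finset.range k, R i ω‖)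
            (n 0).2.le)
          refine le_trans (le_of_eq ?_) (norm_le_pi_norm _ fun i => n i.succ)
          rw [hsum]
          simp only [Fin.forall_fin_succ]
      _ ≤ 4 * ∫ ω, ‖∑ i ∈ Finset.range K, R i ω‖ ^ 2 ∂P := hle
      _ ≤ 4 * (4 ^ d * ∑ a ∈ I with c a 0 < K, ∫ ω, X a ω ^ 2 ∂P) := by
          gcongr
          refine le_trans (le_of_eq ?_) (ih (fun a i => c a i.succ) {a ∈ I | c a 0 < K})
          congr 1 with ω
          congr 2
          ext n
          rw [hsum, Finset.filter_filter]
      _ ≤ 4 ^ (d + 1) * ∑ a ∈ I, ∫ ω, X a ω ^ 2 ∂P := by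
          rw [pow_succ', mul_assoc]
          refine mul_le_mul_of_nonneg_left (mul_le_mul_of_nonneg_left ?_ (by positivity))
            (by norm_num)
          exact Finset.sum_le_sum_of_subset_of_nonneg (Finset.filter_subset _ _)
            fun a _ _ => integral_nonneg fun ω => sq_nonneg (X a ω)

end MultiIndex

/-! ### Counting indices of a given dyadic order. -/

section Counting

/-- The hypothesis expresses that at most c^k elements have level k. Each further coordinate
convolves with c^k, and the n + 1 points of an antidiagonal supply one more factor n + 1. It is used
with c = 2 for indices and c = 1 for dyadic blocks. -/
theorem ENNReal.tsum_comp_sum_fin_le {A : Type*} (l : A → ℕ) (c : ENNReal)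
    (h : ∀ f : ℕ → ENNReal, ∑' a, f (l a) ≤ ∑' k, c ^ k * f k) (e : ℕ) (f : ℕ → ENNReal) :
    ∑' m : Fin (e + 1) → A, f (∑ i, l (m i)) ≤ ∑' k : ℕ, ((k : ENNReal) + 1) ^ e * c ^ k * f k := by
  induction e generalizing f with
  | zero =>
    rw [← (Equiv.funUnique (Fin 1) A).symm.tsum_eq]
    simpa using h f
  | succ e ih =>
    rw [← (Fin.consEquiv fun _ : Fin (e + 2) => A).tsum_eq, ENNReal.tsum_prod']
    calc ∑' a, ∑' m, f (∑ i, l ((Fin.consEquiv fun _ : Fin (e + 2) => A) (a, m) i))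
        = ∑' a, ∑' m : Fin (e + 1) → A, f (l a + ∑ i, l (m i)) := by
          simp [Fin.consEquiv, Fin.sum_univ_succ]
      _ ≤ ∑' a, ∑' k : ℕ, ((k : ENNReal) + 1) ^ e * c ^ k * f (l a + k) :=
          ENNReal.tsum_le_tsum fun a => ih fun k => f (l a + k)
      _ ≤ ∑' j, c ^ j * ∑' k : ℕ, ((k : ENNReal) + 1) ^ e * c ^ k * f (j + k) :=
          h fun j => ∑' k : ℕ, ((k : ENNReal) + 1) ^ e * c ^ k * f (j + k)
      _ = ∑' p : ℕ × ℕ, c ^ p.1 * (((p.2 : ENNReal) + 1) ^ e * c ^ p.2 * f (p.1 + p.2)) := by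
          rw [ENNReal.tsum_prod']
          simp only [ENNReal.tsum_mul_left]
      _ = ∑' n : ℕ, ∑ p ∈ Finset.HasAntidiagonal.antidiagonal n,
            c ^ p.1 * (((p.2 : ENNReal) + 1) ^ e * c ^ p.2 * f (p.1 + p.2)) := by
          rw [← Finset.HasAntidiagonal.sigmaAntidiagonalEquivProd.tsum_eq, ENNReal.tsum_sigma']
          refine tsum_congr fun n => ?_
          rw [tsum_fintype]
          exact Finset.sum_coe_sort (Finset.HasAntidiagonal.antidiagonal n) fun p : ℕ × ℕ =>
            c ^ p.1 * (((p.2 : ENNReal) + 1) ^ e * c ^ p.2 * f (p.1 + p.2))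
      _ ≤ ∑' n : ℕ, ((n : ENNReal) + 1) ^ (e + 1) * c ^ n * f n := by
          refine ENNReal.tsum_le_tsum fun n => ?_
          calc ∑ p ∈ Finset.HasAntidiagonal.antidiagonal n,
                c ^ p.1 * (((p.2 : ENNReal) + 1) ^ e * c ^ p.2 * f (p.1 + p.2))
              ≤ ∑ p ∈ Finset.HasAntidiagonal.antidiagonal n, ((n : ENNReal) + 1) ^ e * c ^ n * f n := by
                refine Finset.sum_le_sum fun p hp => ?_
                have hp' := Finset.HasAntidiagonal.mem_antidiagonal.1 hp
                rw [hp']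
                have h2 : (p.2 : ENNReal) ≤ n := by exact_mod_cast (by omega : p.2 ≤ n)
                calc c ^ p.1 * (((p.2 : ENNReal) + 1) ^ e * c ^ p.2 * f n)
                    = ((p.2 : ENNReal) + 1) ^ e * c ^ (p.1 + p.2) * f n := by rw [pow_add]; ring
                  _ ≤ _ := by rw [hp']; gcongr
            _ = _ := by
                rw [Finset.sum_const, Finset.Nat.card_antidiagonal, nsmul_eq_mul, pow_succ]
                push_cast
                ring

theorem ENNReal.tsum_comp_log_two_le (f : ℕ → ENNReal) :
    ∑' k : ℕ, f (Nat.log 2 (k + 1)) ≤ ∑' j, 2 ^ j * f j := by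
  calc ∑' k : ℕ, f (Nat.log 2 (k + 1))
      = ∑' k : ℕ, ∑' j, if j = Nat.log 2 (k + 1) then f j else 0 :=
        tsum_congr fun k => (tsum_ite_eq _ _).symm
    _ = ∑' j, ∑' k : ℕ, if j = Nat.log 2 (k + 1) then f j else 0 := ENNReal.tsum_comm
    _ ≤ ∑' j, 2 ^ j * f j := by
        refine ENNReal.tsum_le_tsum fun j => ?_
        rw [tsum_eq_sum (s := Finset.Ico (2 ^ j - 1) (2 ^ (j + 1) - 1))]
        · calc _ ≤ ∑ k ∈ Finset.Ico (2 ^ j - 1) (2 ^ (j + 1) - 1), f j :=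
                Finset.sum_le_sum fun k _ => by split_ifs <;> simp
            _ = 2 ^ j * f j := by
                rw [Finset.sum_const, Nat.card_Ico, nsmul_eq_mul]
                have : 2 ^ (j + 1) - 1 - (2 ^ j - 1) = 2 ^ j := by
                  have := Nat.one_le_two_pow (n := j)
                  rw [pow_succ]; omega
                rw [this]; push_cast; rfl
        · intro k hk
          rw [if_neg]
          rintro rfl
          apply hk
          have h1 := Nat.pow_log_le_self 2 (Nat.succ_ne_zero k)
          have h2 := Nat.lt_pow_succ_log_self Nat.one_lt_two (k + 1)
          rw [Finset.mem_Ico]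
          simp only [Nat.succ_eq_add_one] at *
          omega

/-- The dyadic order of magnitude of the product of the numbers `m i + 1`. -/
def dyadicOrder {d : ℕ} (m : Fin d → ℕ) : ℕ := ∑ i, Nat.log 2 (m i + 1)

theorem two_pow_dyadicOrder_le {d : ℕ} (m : Fin d → ℕ) : 2 ^ dyadicOrder m ≤ ∏ i, (m i + 1) := by
  rw [dyadicOrder, ← Finset.prod_pow_eq_pow_sum]
  exact Finset.prod_le_prod' fun i _ => Nat.pow_log_le_self 2 (Nat.succ_ne_zero _)

theorem tsum_dyadicOrder_le (e : ℕ) (f : ℕ → ENNReal) :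
    ∑' m : Fin (e + 1) → ℕ, f (dyadicOrder m) ≤ ∑' k : ℕ, ((k : ENNReal) + 1) ^ e * 2 ^ k * f k :=
  ENNReal.tsum_comp_sum_fin_le (fun k => Nat.log 2 (k + 1)) 2 ENNReal.tsum_comp_log_two_le e f

theorem tsum_sum_fin_le (e : ℕ) (f : ℕ → ENNReal) :
    ∑' j : Fin (e + 1) → ℕ, f (∑ i, j i) ≤ ∑' k : ℕ, ((k : ENNReal) + 1) ^ e * f k := by
  simpa using ENNReal.tsum_comp_sum_fin_le (fun k => k) 1 (fun f => by simp) e f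

end Counting

/-! ### Series controlled by the moment condition. -/

section Moments

theorem RenewalSets.one_le_logE (x : ℝ) : 1 ≤ logE x := by
  unfold logE
  split_ifs with h
  · rfl
  · rw [Real.le_log_iff_exp_le (by linarith [Real.exp_pos 1])]; linarith

theorem RenewalSets.log_le_logE {x : ℝ} (hx : 0 < x) : Real.log x ≤ logE x := by
  unfold logE
  split_ifs with h
  · rw [Real.log_le_iff_le_exp hx]; exact h.le
  · rfl

/-- L counts the levels b^k not exceeding x, so L is at most a multiple of `logE x`, and 2^L ≤ 2 x^β
when L > 0. The summand 1 on the right covers L = 0. -/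
theorem exists_level {b β : ℝ} (hb : 1 < b) (hbβ : b ^ β = 2) (hβ : 0 < β) (e : ℕ) :
    ∃ C : ℝ, 0 < C ∧ ∀ x : ℝ, 0 ≤ x → ∃ L : ℕ, (∀ k : ℕ, b ^ k ≤ x ↔ k < L) ∧
      ((L : ℝ) + 1) ^ e * 2 ^ L ≤ C * (1 + x ^ β * RenewalSets.logE x ^ e) := by
  have hlb : 0 < Real.log b := Real.log_pos hb
  refine ⟨2 * (1 / Real.log b + 2) ^ e, by positivity, fun x hx => ?_⟩
  have hex : ∃ k : ℕ, x < b ^ k := pow_unbounded_of_one_lt x hb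
  classical
  refine ⟨Nat.find hex, fun k => ?_, ?_⟩
  · constructor
    · intro hk
      by_contra! hlt
      exact absurd ((Nat.find_spec hex).trans_le (pow_le_pow_right₀ hb.le hlt)) (not_lt.2 hk)
    · exact fun hk => not_lt.1 (Nat.find_min hex hk)
  · have hE := RenewalSets.one_le_logE x
    have hc : (1 : ℝ) ≤ (1 / Real.log b + 2) ^ e :=
      one_le_pow₀ (by have : 0 < 1 / Real.log b := by positivity
                      linarith)
    have hxb : 0 ≤ x ^ β := Real.rpow_nonneg hx β
    rcases hL : Nat.find hex with _ | l
    · have : 0 ≤ x ^ β * RenewalSets.logE x ^ e := by positivity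
      simp only [Nat.cast_zero, zero_add, one_pow, pow_zero, mul_one]
      nlinarith
    · have hl : b ^ l ≤ x := not_lt.1 (Nat.find_min hex (by omega))
      have hbl : 0 < b ^ l := by positivity
      have h2 : (2 : ℝ) ^ l ≤ x ^ β := by
        calc (2 : ℝ) ^ l = (b ^ l) ^ β := by
              rw [← hbβ, ← Real.rpow_natCast, ← Real.rpow_natCast, ← Real.rpow_mul (by linarith),
                ← Real.rpow_mul (by linarith), mul_comm]
          _ ≤ x ^ β := Real.rpow_le_rpow hbl.le hl hβ.le
      have h3 : (l : ℝ) ≤ 1 / Real.log b * RenewalSets.logE x := by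
        have : l * Real.log b ≤ RenewalSets.logE x := by
          rw [← Real.log_pow]
          exact (Real.log_le_log hbl hl).trans (RenewalSets.log_le_logE (hbl.trans_le hl))
        rw [one_div, inv_mul_eq_div, le_div_iff₀ hlb]
        exact this
      have h4 : (((l + 1 : ℕ) : ℝ) + 1) ≤ (1 / Real.log b + 2) * RenewalSets.logE x := by
        push_cast; linarith
      calc (((l + 1 : ℕ) : ℝ) + 1) ^ e * 2 ^ (l + 1)
          ≤ ((1 / Real.log b + 2) * RenewalSets.logE x) ^ e * (x ^ β * 2) := by
            rw [pow_succ (2 : ℝ)]; gcongr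
        _ = 2 * (1 / Real.log b + 2) ^ e * (x ^ β * RenewalSets.logE x ^ e) := by
            rw [mul_pow]; ring
        _ ≤ _ := by
            gcongr
            linarith

variable {ν : Measure ℝ} [IsProbabilityMeasure ν] {b β : ℝ} {e : ℕ}

/-- By Tonelli it suffices to sum over k at a fixed x, where `exists_level` turns (L+1)^e 2^L into
the integrable moment. The three series below are all of this kind. -/
theorem tsum_lintegral_ne_top_of_level_bound (hb : 1 < b) (hbβ : b ^ β = 2) (hβ : 0 < β)
    (hmom : Integrable (fun x => |x| ^ β * RenewalSets.logE |x| ^ e) ν)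
    {φ : ℕ → ℝ → ℝ} (hφ : ∀ k, Measurable (φ k)) (hφ0 : ∀ k x, 0 ≤ φ k x) (D : ℝ)
    (h : ∀ x : ℝ, ∀ L : ℕ, (∀ k : ℕ, b ^ k ≤ |x| ↔ k < L) →
      Summable (fun k => φ k x) ∧ ∑' k, φ k x ≤ D * (((L : ℝ) + 1) ^ e * 2 ^ L)) :
    ∑' k, ∫⁻ x, ENNReal.ofReal (φ k x) ∂ν ≠ ⊤ := by
  obtain ⟨C, hC, hlev⟩ := exists_level hb hbβ hβ e
  have hbd : ∀ x : ℝ, ∑' k, ENNReal.ofReal (φ k x) ≤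
      ENNReal.ofReal (|D| * (C * (1 + |x| ^ β * RenewalSets.logE |x| ^ e))) := by
    intro x
    obtain ⟨L, hL, hLC⟩ := hlev |x| (abs_nonneg x)
    obtain ⟨hs, hle⟩ := h x L hL
    rw [← ENNReal.ofReal_tsum_of_nonneg (fun k => hφ0 k x) hs]
    refine ENNReal.ofReal_le_ofReal (hle.trans ?_)
    calc D * (((L : ℝ) + 1) ^ e * 2 ^ L) ≤ |D| * (((L : ℝ) + 1) ^ e * 2 ^ L) := by
          gcongr; exact le_abs_self D
      _ ≤ _ := by gcongr
  rw [← lintegral_tsum fun k => (hφ k).ennreal_ofReal.aemeasurable]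
  refine ne_top_of_le_ne_top ?_ (lintegral_mono hbd)
  have hi : Integrable (fun x => |D| * (C * (1 + |x| ^ β * RenewalSets.logE |x| ^ e))) ν :=
    (((integrable_const 1).add hmom).const_mul C).const_mul |D|
  exact ((hasFiniteIntegral_iff_ofReal (.of_forall fun x => by
    have := RenewalSets.one_le_logE |x|; positivity)).1 hi.2).ne

theorem tsum_measure_le_abs_ne_top (hb : 1 < b) (hbβ : b ^ β = 2) (hβ : 0 < β)
    (hmom : Integrable (fun x => |x| ^ β * RenewalSets.logE |x| ^ e) ν) :
    ∑' k : ℕ, ((k : ENNReal) + 1) ^ e * 2 ^ k * ν {x | b ^ k ≤ |x|} ≠ ⊤ := by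
  have hm : ∀ k : ℕ, MeasurableSet {x : ℝ | b ^ k ≤ |x|} := fun k =>
    measurableSet_le measurable_const measurable_id.abs
  have := tsum_lintegral_ne_top_of_level_bound hb hbβ hβ hmom
    (φ := fun k => {x : ℝ | b ^ k ≤ |x|}.indicator fun _ => ((k : ℝ) + 1) ^ e * 2 ^ k)
    (fun k => measurable_const.indicator (hm k))
    (fun k x => Set.indicator_nonneg (fun _ _ => by positivity) _) 1 ?_
  · convert this using 4 with k
    have : (fun x => ENNReal.ofReal ({x : ℝ | b ^ k ≤ |x|}.indicator
        (fun _ => ((k : ℝ) + 1) ^ e * 2 ^ k) x)) = {x : ℝ | b ^ k ≤ |x|}.indicator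
        (fun _ => ((k : ENNReal) + 1) ^ e * 2 ^ k) := by
      ext x
      by_cases hx : b ^ k ≤ |x|
      · simp only [Set.indicator, Set.mem_ofPred_eq, hx, if_true]
        rw [ENNReal.ofReal_mul (by positivity), ENNReal.ofReal_pow (by positivity),
          ENNReal.ofReal_add (by positivity) zero_le_one, ENNReal.ofReal_pow zero_le_two]
        simp
      · simp [Set.indicator, hx]
    rw [this, lintegral_indicator_const (hm k)]
  · intro x L hL
    have h0 : ∀ k ∉ Finset.range L, {x : ℝ | b ^ k ≤ |x|}.indicator
        (fun _ => ((k : ℝ) + 1) ^ e * 2 ^ k) x = 0 := fun k hk =>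
      Set.indicator_of_notMem (s := {x : ℝ | b ^ k ≤ |x|})
        (fun h => hk (Finset.mem_range.2 ((hL k).1 h))) _
    refine ⟨summable_of_ne_finset_zero h0, ?_⟩
    rw [tsum_eq_sum h0]
    calc _ ≤ ∑ k ∈ Finset.range L, ((L : ℝ) + 1) ^ e * 2 ^ k := by
          refine Finset.sum_le_sum fun k hk => ?_
          have hk := Finset.mem_range.1 hk
          rw [Set.indicator_of_mem (show x ∈ {x : ℝ | b ^ k ≤ |x|} from (hL k).2 hk)]
          gcongr
      _ ≤ 1 * (((L : ℝ) + 1) ^ e * 2 ^ L) := by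
          rw [← Finset.mul_sum, one_mul, geom_sum_eq (by norm_num)]
          gcongr
          norm_num

/-- Since 2/b > 1, the geometric sum over k < L is comparable to its top term, and |x| ≤ b^L
restores 2^L. The condition b < 2 amounts to β > 1. -/
theorem tsum_lintegral_tail_ne_top (hb : 1 < b) (hb2 : b < 2) (hbβ : b ^ β = 2) (hβ : 0 < β)
    (hmom : Integrable (fun x => |x| ^ β * RenewalSets.logE |x| ^ e) ν) :
    ∑' k : ℕ, ∫⁻ x, ENNReal.ofReal ({x : ℝ | b ^ k ≤ |x|}.indicator
      (fun x => ((k : ℝ) + 1) ^ e * (2 / b) ^ k * |x|) x) ∂ν ≠ ⊤ := by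
  have hm : ∀ k : ℕ, MeasurableSet {x : ℝ | b ^ k ≤ |x|} := fun k =>
    measurableSet_le measurable_const measurable_id.abs
  have hb0 : 0 < b := by linarith
  have hr : 1 < 2 / b := by rwa [lt_div_iff₀ hb0, one_mul]
  refine tsum_lintegral_ne_top_of_level_bound hb hbβ hβ hmom
    (fun k => (measurable_id.abs.const_mul _).indicator (hm k))
    (fun k x => Set.indicator_nonneg (fun _ _ => by positivity) _) (1 / (2 / b - 1)) ?_
  intro x L hL
  have h0 : ∀ k ∉ Finset.range L, {x : ℝ | b ^ k ≤ |x|}.indicator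
      (fun x => ((k : ℝ) + 1) ^ e * (2 / b) ^ k * |x|) x = 0 := fun k hk =>
    Set.indicator_of_notMem (s := {x : ℝ | b ^ k ≤ |x|})
        (fun h => hk (Finset.mem_range.2 ((hL k).1 h))) _
  have hxL : |x| ≤ b ^ L := by
    have := (hL L).not.2 (lt_irrefl L)
    exact (not_le.1 this).le
  refine ⟨summable_of_ne_finset_zero h0, ?_⟩
  rw [tsum_eq_sum h0]
  calc _ ≤ ∑ k ∈ Finset.range L, ((L : ℝ) + 1) ^ e * b ^ L * (2 / b) ^ k := by
        refine Finset.sum_le_sum fun k hk => ?_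
        have hk := Finset.mem_range.1 hk
        rw [Set.indicator_of_mem (show x ∈ {x : ℝ | b ^ k ≤ |x|} from (hL k).2 hk), mul_right_comm]
        gcongr
    _ ≤ ((L : ℝ) + 1) ^ e * b ^ L * ((2 / b) ^ L / (2 / b - 1)) := by
        rw [← Finset.mul_sum, geom_sum_eq hr.ne']
        gcongr
        linarith
    _ = 1 / (2 / b - 1) * (((L : ℝ) + 1) ^ e * 2 ^ L) := by
        have : (2 : ℝ) ^ L = b ^ L * (2 / b) ^ L := by
          rw [← mul_pow, mul_div_cancel₀ _ hb0.ne']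
        rw [this]
        ring

theorem summable_add_one_pow_mul_geometric {r : ℝ} (hr0 : 0 < r) (hr1 : r < 1) (e : ℕ) :
    Summable fun i : ℕ => ((i : ℝ) + 1) ^ e * r ^ i := by
  have h := (summable_nat_add_iff 1).2
    (summable_pow_mul_geometric_of_norm_lt_one e (r := r) (by rwa [Real.norm_of_nonneg hr0.le]))
  refine (h.mul_right r⁻¹).congr fun i => ?_
  push_cast
  rw [pow_succ]
  field_simp

/-- Only k ≥ L contributes, and 2/b² < 1 (that is, β < 2) makes the series comparable to its first
term. Substituting k = i + L, the bound i + L + 1 ≤ (i + 1)(L + 1) separates the variables. -/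
theorem tsum_lintegral_truncated_sq_ne_top (hb : 1 < b) (hb2 : 2 < b ^ 2) (hbβ : b ^ β = 2)
    (hβ : 0 < β) (hmom : Integrable (fun x => |x| ^ β * RenewalSets.logE |x| ^ e) ν) :
    ∑' k : ℕ, ∫⁻ x, ENNReal.ofReal ({x : ℝ | |x| < b ^ k}.indicator
      (fun x => ((k : ℝ) + 1) ^ e * (2 / b ^ 2) ^ k * x ^ 2) x) ∂ν ≠ ⊤ := by
  have hm : ∀ k : ℕ, MeasurableSet {x : ℝ | |x| < b ^ k} := fun k =>
    measurableSet_lt measurable_id.abs measurable_const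
  have hb0 : 0 < b := by linarith
  have hr0 : 0 < 2 / b ^ 2 := by positivity
  have hr : 2 / b ^ 2 < 1 := by rwa [div_lt_one (by positivity)]
  have hs := summable_add_one_pow_mul_geometric hr0 hr e
  refine tsum_lintegral_ne_top_of_level_bound hb hbβ hβ hmom
    (fun k => ((measurable_id.pow_const 2).const_mul _).indicator (hm k))
    (fun k x => Set.indicator_nonneg (fun _ _ => by positivity) _)
    (∑' i : ℕ, ((i : ℝ) + 1) ^ e * (2 / b ^ 2) ^ i) ?_
  intro x L hL
  have hxL : |x| < b ^ L := not_le.1 ((hL L).not.2 (lt_irrefl L))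
  have h0 : ∀ k ∈ Finset.range L, {x : ℝ | |x| < b ^ k}.indicator
      (fun x => ((k : ℝ) + 1) ^ e * (2 / b ^ 2) ^ k * x ^ 2) x = 0 := fun k hk =>
    Set.indicator_of_notMem (s := {x : ℝ | |x| < b ^ k})
      (fun h => absurd ((hL k).2 (Finset.mem_range.1 hk)) (not_le.2 h)) _
  have hle : ∀ i : ℕ, {x : ℝ | |x| < b ^ (i + L)}.indicator
      (fun x => (((i + L : ℕ) : ℝ) + 1) ^ e * (2 / b ^ 2) ^ (i + L) * x ^ 2) x ≤
      ((i : ℝ) + 1) ^ e * (2 / b ^ 2) ^ i * (((L : ℝ) + 1) ^ e * 2 ^ L) := by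
    intro i
    refine (Set.indicator_le_self' (fun _ _ => by positivity) x).trans ?_
    have hx2 : x ^ 2 ≤ (b ^ L) ^ 2 := by
      rw [← sq_abs x]; gcongr
    have h1 : ((i + L : ℕ) : ℝ) + 1 ≤ ((i : ℝ) + 1) * ((L : ℝ) + 1) := by
      push_cast
      have : (0 : ℝ) ≤ (i : ℝ) * L := by positivity
      linarith
    have h2 : (2 / b ^ 2) ^ L * (b ^ L) ^ 2 = 2 ^ L := by
      rw [div_pow, ← pow_mul, ← pow_mul, mul_comm L 2, div_mul_cancel₀ _ (by positivity)]
    calc _ ≤ (((i : ℝ) + 1) * ((L : ℝ) + 1)) ^ e * (2 / b ^ 2) ^ (i + L) * (b ^ L) ^ 2 := by gcongr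
      _ = ((i : ℝ) + 1) ^ e * (2 / b ^ 2) ^ i *
          (((L : ℝ) + 1) ^ e * ((2 / b ^ 2) ^ L * (b ^ L) ^ 2)) := by rw [mul_pow, pow_add]; ring
      _ = _ := by rw [h2]
  have hsL := hs.mul_right (((L : ℝ) + 1) ^ e * 2 ^ L)
  have hs' := Summable.of_nonneg_of_le
    (fun i => Set.indicator_nonneg (fun _ _ => by positivity) x) hle hsL
  have hsum := (summable_nat_add_iff (f := fun k : ℕ => {x : ℝ | |x| < b ^ k}.indicator
      (fun x => ((k : ℝ) + 1) ^ e * (2 / b ^ 2) ^ k * x ^ 2) x) L).1 hs'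
  refine ⟨hsum, ?_⟩
  rw [← hsum.sum_add_tsum_nat_add L, Finset.sum_eq_zero h0, zero_add, ← tsum_mul_right]
  exact hs'.tsum_le_tsum hle hsL

end Moments

/-! ### Deterministic sums over boxes, and truncation. -/

/-- The multi-indices that are smaller than `n` in each component. -/
def indexBox {d : ℕ} (n : Fin d → ℕ) : Finset (Fin d → ℕ) :=
  Fintype.piFinset fun i => Finset.range (n i)

theorem mem_indexBox {d : ℕ} {n m : Fin d → ℕ} : m ∈ indexBox n ↔ ∀ i, m i < n i := by
  simp [indexBox]

theorem card_indexBox {d : ℕ} (n : Fin d → ℕ) : (indexBox n).card = ∏ i, n i := by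
  simp [indexBox]

theorem two_pow_dyadicOrder_le_of_mem {d : ℕ} {n m : Fin d → ℕ} (h : m ∈ indexBox n) :
    2 ^ dyadicOrder m ≤ ∏ i, n i :=
  (two_pow_dyadicOrder_le m).trans (Finset.prod_le_prod' fun i _ => mem_indexBox.1 h i)

theorem pow_le_rpow_one_div {b β x : ℝ} (hb : 0 < b) (hbβ : b ^ β = 2) (hβ : 0 < β) {k : ℕ}
    (h : 2 ^ k ≤ x) : b ^ k ≤ x ^ (1 / β) := by
  calc b ^ k = ((2 : ℝ) ^ k) ^ (1 / β) := by
        rw [← hbβ, ← Real.rpow_natCast, ← Real.rpow_natCast, ← Real.rpow_mul (by positivity),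
          ← Real.rpow_mul (by positivity)]
        congr 1
        field_simp
    _ ≤ _ := Real.rpow_le_rpow (by positivity) h (by positivity)

theorem exists_abs_sum_le_of_finite {ι : Type*} {g : ι → ℝ} (h : {m | g m ≠ 0}.Finite) :
    ∃ C : ℝ, ∀ s : Finset ι, |∑ m ∈ s, g m| ≤ C := by
  classical
  refine ⟨∑ m ∈ h.toFinset, |g m|, fun s => (Finset.abs_sum_le_sum_abs _ _).trans ?_⟩
  rw [← Finset.sum_filter_add_sum_filter_not s (fun m => g m ≠ 0),
    Finset.sum_eq_zero (s := s.filter fun m => ¬ g m ≠ 0), add_zero]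
  · refine Finset.sum_le_sum_of_subset_of_nonneg (fun m hm => ?_) fun _ _ _ => abs_nonneg _
    exact h.mem_toFinset.2 (Finset.mem_filter.1 hm).2
  · intro m hm
    have := (Finset.mem_filter.1 hm).2
    simpa using this

/-- A Kronecker lemma: outside a finite set the weighted series has mass below δ, and on the box of
n every weight b^k is at most |n|^(1/β). -/
theorem exists_sum_le_of_summable {d : ℕ} {b β : ℝ} (hb : 0 < b) (hbβ : b ^ β = 2) (hβ : 0 < β)
    {q : (Fin d → ℕ) → ℝ} (hq : ∀ m, 0 ≤ q m) (hs : Summable fun m => q m / b ^ dyadicOrder m)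
    {δ : ℝ} (hδ : 0 < δ) :
    ∃ C : ℝ, ∀ n : Fin d → ℕ,
      ∑ m ∈ indexBox n, q m ≤ δ * (∏ i, (n i : ℝ)) ^ (1 / β) + C := by
  classical
  obtain ⟨F, hF⟩ := summable_iff_vanishing_norm.1 hs δ hδ
  refine ⟨∑ m ∈ F, q m, fun n => ?_⟩
  have h1 : ∑ m ∈ indexBox n \ F, q m ≤ δ * (∏ i, (n i : ℝ)) ^ (1 / β) := by
    calc ∑ m ∈ indexBox n \ F, q m
        ≤ ∑ m ∈ indexBox n \ F, (q m / b ^ dyadicOrder m) * (∏ i, (n i : ℝ)) ^ (1 / β) := by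
          refine Finset.sum_le_sum fun m hm => ?_
          have h2 := two_pow_dyadicOrder_le_of_mem (Finset.mem_sdiff.1 hm).1
          have h3 : b ^ dyadicOrder m ≤ (∏ i, (n i : ℝ)) ^ (1 / β) :=
            pow_le_rpow_one_div hb hbβ hβ (by exact_mod_cast h2)
          calc q m = q m / b ^ dyadicOrder m * b ^ dyadicOrder m := by
                rw [div_mul_cancel₀ _ (by positivity)]
            _ ≤ _ := by
                have := hq m
                gcongr
      _ ≤ _ := by
          rw [← Finset.sum_mul]
          gcongr
          exact (le_abs_self _).trans (hF _ Finset.sdiff_disjoint).le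
  calc ∑ m ∈ indexBox n, q m
      = ∑ m ∈ indexBox n \ F, q m + ∑ m ∈ indexBox n ∩ F, q m := by
        rw [add_comm, Finset.sum_inter_add_sum_sdiff]
    _ ≤ _ := add_le_add h1 (Finset.sum_le_sum_of_subset_of_nonneg Finset.inter_subset_right
        fun m _ _ => hq m)

theorem finite_setOf_dyadicOrder_lt {d : ℕ} (k : ℕ) :
    {m : Fin d → ℕ | dyadicOrder m < k}.Finite := by
  refine (indexBox fun _ : Fin d => 2 ^ k).finite_toSet.subset fun m (hm : dyadicOrder m < k) => ?_
  refine mem_indexBox.2 fun i => ?_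
  have h1 : Nat.log 2 (m i + 1) ≤ dyadicOrder m :=
    Finset.single_le_sum (f := fun i => Nat.log 2 (m i + 1)) (fun _ _ => Nat.zero_le _)
      (Finset.mem_univ i)
  have h2 := Nat.lt_pow_of_log_lt Nat.one_lt_two (h1.trans_lt hm)
  omega

/-- A Cesàro argument, possible because only finitely many indices have order below a given k. -/
theorem exists_sum_le_of_tendsto_zero {d : ℕ} {h : ℕ → ℝ} (h0 : ∀ k, 0 ≤ h k)
    (ht : Tendsto h atTop (nhds 0)) {δ : ℝ} (hδ : 0 < δ) :
    ∃ C : ℝ, ∀ n : Fin d → ℕ,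
      ∑ m ∈ indexBox n, h (dyadicOrder m) ≤ δ * ∏ i, (n i : ℝ) + C := by
  classical
  obtain ⟨k, hk⟩ := eventually_atTop.1 (ht.eventually (gt_mem_nhds hδ))
  have hfin := finite_setOf_dyadicOrder_lt (d := d) k
  refine ⟨∑ m ∈ hfin.toFinset, h (dyadicOrder m), fun n => ?_⟩
  calc ∑ m ∈ indexBox n, h (dyadicOrder m)
      = ∑ m ∈ indexBox n \ hfin.toFinset, h (dyadicOrder m) +
          ∑ m ∈ indexBox n ∩ hfin.toFinset, h (dyadicOrder m) := by
        rw [add_comm, Finset.sum_inter_add_sum_sdiff]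
    _ ≤ ∑ m ∈ indexBox n \ hfin.toFinset, δ +
          ∑ m ∈ hfin.toFinset, h (dyadicOrder m) := by
        refine add_le_add (Finset.sum_le_sum fun m hm => ?_)
          (Finset.sum_le_sum_of_subset_of_nonneg Finset.inter_subset_right fun m _ _ => h0 _)
        refine (hk _ ?_).le
        by_contra! hlt
        exact (Finset.mem_sdiff.1 hm).2 (hfin.mem_toFinset.2 hlt)
    _ ≤ _ := by
        gcongr
        rw [Finset.sum_const, nsmul_eq_mul, mul_comm]
        gcongr
        calc ((indexBox n \ hfin.toFinset).card : ℝ) ≤ ((indexBox n).card : ℝ) := by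
              exact_mod_cast Finset.card_le_card Finset.sdiff_subset
          _ = _ := by rw [card_indexBox]; push_cast; rfl

/-- The truncation of a real number at the level `b ^ k`. -/
noncomputable def truncAt (b : ℝ) (k : ℕ) (x : ℝ) : ℝ := {x : ℝ | |x| < b ^ k}.indicator id x

section Truncation

variable {b : ℝ} (k : ℕ)

theorem measurable_truncAt : Measurable (truncAt b k) :=
  measurable_id.indicator (measurableSet_lt measurable_id.abs measurable_const)

theorem abs_truncAt_le (hb : 0 < b) (x : ℝ) : |truncAt b k x| ≤ b ^ k := by
  by_cases hx : |x| < b ^ k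
  · simpa [truncAt, Set.indicator, hx] using hx.le
  · simpa [truncAt, Set.indicator, hx] using (pow_pos hb k).le

theorem sq_truncAt_mono (hb : 1 ≤ b) {k l : ℕ} (hkl : k ≤ l) (x : ℝ) :
    truncAt b k x ^ 2 ≤ truncAt b l x ^ 2 := by
  by_cases hx : |x| < b ^ k
  · have : |x| < b ^ l := hx.trans_le (pow_le_pow_right₀ hb hkl)
    simp [truncAt, Set.indicator, hx, this]
  · have : truncAt b k x = 0 := by simp [truncAt, Set.indicator, hx]
    rw [this, zero_pow two_ne_zero]; exact sq_nonneg _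

theorem sub_truncAt (x : ℝ) : x - truncAt b k x = {x : ℝ | b ^ k ≤ |x|}.indicator id x := by
  by_cases hx : |x| < b ^ k
  · simp [truncAt, Set.indicator, hx]
  · simp [truncAt, Set.indicator, hx, not_lt.1 hx]

variable {ν : Measure ℝ}

theorem memLp_truncAt [IsProbabilityMeasure ν] (hb : 0 < b) (p : ENNReal) : MemLp (truncAt b k) p ν :=
  MemLp.of_bound (measurable_truncAt k).aestronglyMeasurable (b ^ k)
    (.of_forall fun x => abs_truncAt_le k hb x)

theorem integrable_abs_tail (hν : Integrable (fun x => x) ν) :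
    Integrable ({x : ℝ | b ^ k ≤ |x|}.indicator fun x => |x|) ν :=
  hν.abs.indicator (measurableSet_le measurable_const measurable_id.abs)

theorem abs_integral_truncAt_sub_le [IsProbabilityMeasure ν] (hb : 0 < b) (hν : Integrable (fun x => x) ν) :
    |∫ x, truncAt b k x ∂ν - ∫ x, x ∂ν| ≤
      ∫ x, {x : ℝ | b ^ k ≤ |x|}.indicator (fun x => |x|) x ∂ν := by
  rw [abs_sub_comm, ← integral_sub hν ((memLp_truncAt k hb 1).integrable le_rfl)]
  refine (abs_integral_le_integral_abs).trans (le_of_eq ?_)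
  congr 1 with x
  rw [sub_truncAt]
  by_cases hx : b ^ k ≤ |x| <;> simp [Set.indicator, hx]

theorem tendsto_integral_abs_tail (hb : 1 < b) (hν : Integrable (fun x => x) ν) :
    Tendsto (fun k : ℕ => ∫ x, {x : ℝ | b ^ k ≤ |x|}.indicator (fun x => |x|) x ∂ν) atTop
      (nhds 0) := by
  have h := tendsto_integral_of_dominated_convergence (μ := ν)
    (F := fun k : ℕ => {x : ℝ | b ^ k ≤ |x|}.indicator (fun x => |x|)) (f := fun _ => 0)
    (fun x => |x|) (fun k => (integrable_abs_tail k hν).aestronglyMeasurable) hν.abs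
    (fun k => .of_forall fun x => by
      by_cases hx : b ^ k ≤ |x| <;> simp [Set.indicator, hx])
    (.of_forall fun x => by
      refine tendsto_const_nhds.congr' ?_
      filter_upwards [(tendsto_pow_atTop_atTop_of_one_lt hb).eventually (eventually_gt_atTop |x|)]
        with k hk
      simp [Set.indicator, hk])
  simpa using h

end Truncation

/-! ### The Marcinkiewicz-Zygmund strong law. -/

section StrongLaw

variable {Ω : Type*} {mΩ : MeasurableSpace Ω} {P : Measure Ω}
  {ν : Measure ℝ} [IsProbabilityMeasure ν] {b β : ℝ} {e : ℕ} {Y : (Fin (e + 1) → ℕ) → Ω → ℝ}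

theorem exists_abs_sum_integral_truncAt_sub_le (hb : 1 < b) (hbβ : b ^ β = 2) (hβ : 1 ≤ β)
    (hν : Integrable (fun x => x) ν)
    (hmom : Integrable (fun x => |x| ^ β * RenewalSets.logE |x| ^ e) ν) {δ : ℝ} (hδ : 0 < δ) :
    ∃ C : ℝ, ∀ n : Fin (e + 1) → ℕ,
      |∑ m ∈ indexBox n, (∫ x, truncAt b (dyadicOrder m) x ∂ν - ∫ x, x ∂ν)| ≤
        δ * (∏ i, (n i : ℝ)) ^ (1 / β) + C := by
  have hb0 : 0 < b := by linarith
  let h : ℕ → ℝ := fun k => ∫ x, {x : ℝ | b ^ k ≤ |x|}.indicator (fun x => |x|) x ∂ν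
  have h0 : ∀ k, 0 ≤ h k := fun k =>
    integral_nonneg fun x => Set.indicator_nonneg (fun _ _ => abs_nonneg _) x
  suffices hsuff : ∃ C : ℝ, ∀ n : Fin (e + 1) → ℕ,
      ∑ m ∈ indexBox n, h (dyadicOrder m) ≤ δ * (∏ i, (n i : ℝ)) ^ (1 / β) + C by
    obtain ⟨C, hC⟩ := hsuff
    exact ⟨C, fun n => (Finset.abs_sum_le_sum_abs _ _).trans
      ((Finset.sum_le_sum fun m _ => abs_integral_truncAt_sub_le _ hb0 hν).trans (hC n))⟩
  -- For β = 1 the ratio 2/b equals 1 and the tail series estimate is unavailable; there |n|^(1/β) =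
  -- |n|, and tails tending to 0 suffice.
  rcases hβ.eq_or_lt with rfl | hβ1
  · simpa using exists_sum_le_of_tendsto_zero h0 (tendsto_integral_abs_tail hb hν) hδ
  · refine exists_sum_le_of_summable hb0 hbβ (by linarith) (fun m => h0 _) ?_ hδ
    have hb2 : b < 2 := by
      rw [← hbβ]
      calc b = b ^ (1 : ℝ) := (Real.rpow_one b).symm
        _ < b ^ β := Real.rpow_lt_rpow_of_exponent_lt hb hβ1
    have hle := tsum_dyadicOrder_le e fun k => ENNReal.ofReal (h k / b ^ k)
    have hfin := tsum_lintegral_tail_ne_top hb hb2 hbβ (by linarith) hmom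
    have heq : ∀ k : ℕ, ((k : ENNReal) + 1) ^ e * 2 ^ k * ENNReal.ofReal (h k / b ^ k) =
        ∫⁻ x, ENNReal.ofReal ({x : ℝ | b ^ k ≤ |x|}.indicator
          (fun x => ((k : ℝ) + 1) ^ e * (2 / b) ^ k * |x|) x) ∂ν := by
      intro k
      have h1 : (fun x => {x : ℝ | b ^ k ≤ |x|}.indicator
          (fun x => ((k : ℝ) + 1) ^ e * (2 / b) ^ k * |x|) x) = fun x =>
          ((k : ℝ) + 1) ^ e * (2 / b) ^ k * {x : ℝ | b ^ k ≤ |x|}.indicator (fun x => |x|) x := by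
        ext x
        by_cases hx : b ^ k ≤ |x| <;> simp [Set.indicator, hx]
      rw [← ofReal_integral_eq_lintegral_ofReal, h1, integral_const_mul]
      · rw [← ENNReal.ofReal_natCast, ← ENNReal.ofReal_one, ← ENNReal.ofReal_add (by positivity)
          zero_le_one, ← ENNReal.ofReal_pow (by positivity), ← ENNReal.ofReal_ofNat,
          ← ENNReal.ofReal_pow (by positivity), ← ENNReal.ofReal_mul (by positivity),
          ← ENNReal.ofReal_mul (by positivity), div_pow]
        congr 1
        ring
      · refine Integrable.congr ?_ (.of_forall fun x => (congrFun h1 x).symm)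
        exact (integrable_abs_tail k hν).const_mul _
      · exact .of_forall fun x => Set.indicator_nonneg (fun _ _ => by positivity) x
    simp only [heq] at hle
    have hne := ne_top_of_le_ne_top hfin hle
    refine (ENNReal.summable_toReal hne).congr fun m => ?_
    exact ENNReal.toReal_ofReal (div_nonneg (h0 _) (by positivity))

/-- By Borel-Cantelli only finitely many summands are changed by truncation, which bounds all the
sums at once. -/
theorem ae_exists_abs_sum_sub_truncAt_le (hb : 1 < b) (hbβ : b ^ β = 2) (hβ : 0 < β)
    (hmom : Integrable (fun x => |x| ^ β * RenewalSets.logE |x| ^ e) ν)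
    (hYm : ∀ m, Measurable (Y m)) (hY : ∀ m, P.map (Y m) = ν) :
    ∀ᵐ ω ∂P, ∃ C : ℝ, ∀ n : Fin (e + 1) → ℕ,
      |∑ m ∈ indexBox n, (Y m ω - truncAt b (dyadicOrder m) (Y m ω))| ≤ C := by
  have hfin : ∑' m, P {ω | b ^ dyadicOrder m ≤ |Y m ω|} ≠ ⊤ := by
    refine ne_top_of_le_ne_top (tsum_measure_le_abs_ne_top hb hbβ hβ hmom) (le_trans (le_of_eq ?_)
      (tsum_dyadicOrder_le e fun k => ν {x | b ^ k ≤ |x|}))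
    refine tsum_congr fun m => ?_
    have hm : MeasurableSet {x : ℝ | b ^ dyadicOrder m ≤ |x|} :=
      measurableSet_le measurable_const measurable_id.abs
    rw [← hY m, Measure.map_apply (hYm m) hm]
    rfl
  filter_upwards [ae_finite_setOfPred_mem hfin] with ω hω
  obtain ⟨C, hC⟩ := exists_abs_sum_le_of_finite
    (g := fun m => Y m ω - truncAt b (dyadicOrder m) (Y m ω)) (hω.subset fun m hm => by
      change b ^ dyadicOrder m ≤ |Y m ω|
      by_contra hlt
      refine hm ?_
      rw [sub_truncAt]
      exact Set.indicator_of_notMem (s := {x : ℝ | b ^ dyadicOrder m ≤ |x|}) hlt _)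
  exact ⟨C, fun n => hC _⟩

variable [IsProbabilityMeasure P]

/-- Chebyshev combined with the maximal inequality on the dyadic block j. The factor 8^(e+1) is
4^(e+1) from the maximal inequality times 2^(e+1) from the size of the block. -/
theorem measure_boxSum_truncAt_ge_le (hb : 1 < b) (hYm : ∀ m, Measurable (Y m))
    (hY : ∀ m, P.map (Y m) = ν) (hind : iIndepFun Y P) {δ : ℝ} (hδ : 0 < δ)
    (j : Fin (e + 1) → ℕ) (K : ℕ) :
    P {ω | δ * b ^ (∑ i, j i) ≤ ‖fun n : Fin (e + 1) → Fin K =>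
        ∑ a ∈ indexBox (fun i => 2 ^ (j i + 1) - 1) with ∀ i, a i < (n i : ℕ),
          (truncAt b (dyadicOrder a) (Y a ω) - ∫ x, truncAt b (dyadicOrder a) x ∂ν)‖} ≤
      ENNReal.ofReal (8 ^ (e + 1) / δ ^ 2 * ((2 / b ^ 2) ^ (∑ i, j i) *
        ∫ x, truncAt b (∑ i, j i) x ^ 2 ∂ν)) := by
  have hb0 : 0 < b := by linarith
  set J := ∑ i, j i with hJ
  set I := indexBox (fun i => 2 ^ (j i + 1) - 1) with hI
  let Z : (Fin (e + 1) → ℕ) → Ω → ℝ := fun a ω =>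
    truncAt b (dyadicOrder a) (Y a ω) - ∫ x, truncAt b (dyadicOrder a) x ∂ν
  have hZm : ∀ a, Measurable (Z a) := fun a =>
    ((measurable_truncAt _).comp (hYm a)).sub_const _
  have hT2 : ∀ a, MemLp (fun ω => truncAt b (dyadicOrder a) (Y a ω)) 2 P := fun a =>
    MemLp.of_bound ((measurable_truncAt _).comp (hYm a)).aestronglyMeasurable _
      (.of_forall fun ω => abs_truncAt_le _ hb0 _)
  have hZ2 : ∀ a, MemLp (Z a) 2 P := fun a => (hT2 a).sub (memLp_const _)
  have hmean : ∀ a, ∫ ω, truncAt b (dyadicOrder a) (Y a ω) ∂P =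
      ∫ x, truncAt b (dyadicOrder a) x ∂ν := fun a => by
    rw [← hY a, integral_map (hYm a).aemeasurable (measurable_truncAt _).aestronglyMeasurable]
  have hZ0 : ∀ a, ∫ ω, Z a ω ∂P = 0 := fun a => by
    simp only [Z]
    rw [integral_sub ((hT2 a).integrable (by norm_num)) (integrable_const _), hmean a]
    simp
  have hZi : iIndepFun Z P := hind.comp
    (fun a x => truncAt b (dyadicOrder a) x - ∫ x, truncAt b (dyadicOrder a) x ∂ν)
    fun a => (measurable_truncAt _).sub_const _
  have hmax := integral_sq_norm_boxSum_le hZm hZ2 hZ0 hZi K (fun a => a) I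
  set v := ∫ x, truncAt b J x ^ 2 ∂ν with hv
  have hv0 : 0 ≤ v := integral_nonneg fun x => sq_nonneg _
  have hvar : ∀ a ∈ I, ∫ ω, Z a ω ^ 2 ∂P ≤ v := by
    intro a ha
    have hle : dyadicOrder a ≤ J := by
      refine Finset.sum_le_sum fun i _ => ?_
      have h1 := mem_indexBox.1 ha i
      exact Nat.lt_succ_iff.1 (Nat.log_lt_of_lt_pow (Nat.succ_ne_zero _) (by omega))
    have h1 : ∫ ω, Z a ω ^ 2 ∂P ≤ ∫ ω, truncAt b (dyadicOrder a) (Y a ω) ^ 2 ∂P := by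
      have := variance_le_expectation_sq (μ := P)
        ((measurable_truncAt (b := b) (dyadicOrder a)).comp (hYm a)).aestronglyMeasurable
      rw [variance_eq_integral ((measurable_truncAt _).comp (hYm a)).aemeasurable] at this
      simp only [Function.comp_apply, Pi.pow_apply, hmean a] at this
      exact this
    refine h1.trans ?_
    rw [← integral_map (f := fun x => truncAt b (dyadicOrder a) x ^ 2) (hYm a).aemeasurable
      ((measurable_truncAt _).pow_const 2).aestronglyMeasurable, hY a]
    exact integral_mono (memLp_truncAt _ hb0 2).integrable_sq (memLp_truncAt _ hb0 2).integrable_sq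
      (sq_truncAt_mono hb.le hle)
  have hcard : (I.card : ℝ) ≤ 2 ^ J * 2 ^ (e + 1) := by
    have : I.card ≤ 2 ^ J * 2 ^ (e + 1) := by
      rw [hI, card_indexBox]
      calc ∏ i, (2 ^ (j i + 1) - 1) ≤ ∏ i : Fin (e + 1), (2 ^ j i * 2) :=
            Finset.prod_le_prod' fun i _ => by rw [pow_succ]; omega
        _ = 2 ^ J * 2 ^ (e + 1) := by
            rw [Finset.prod_mul_distrib, Finset.prod_pow_eq_pow_sum]; simp [hJ]
    exact_mod_cast this
  have hsum : ∑ a ∈ I, ∫ ω, Z a ω ^ 2 ∂P ≤ 2 ^ J * 2 ^ (e + 1) * v := by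
    calc _ ≤ ∑ a ∈ I, v := Finset.sum_le_sum hvar
      _ = I.card * v := by rw [Finset.sum_const, nsmul_eq_mul]
      _ ≤ _ := by gcongr
  let W : Ω → (Fin (e + 1) → Fin K) → ℝ := fun ω n => ∑ a ∈ I with ∀ i, a i < (n i : ℕ), Z a ω
  have hW2 : MemLp W 2 P := by
    rw [memLp_pi_iff]
    exact fun n => memLp_finsetSum _ fun a _ => hZ2 a
  have hcheb := mul_meas_ge_le_integral_of_nonneg (μ := P) (f := fun ω => ‖W ω‖ ^ 2)
    (.of_forall fun ω => sq_nonneg _) hW2.norm.integrable_sq ((δ * b ^ J) ^ 2)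
  have hset : {ω | δ * b ^ J ≤ ‖W ω‖} ⊆ {ω | (δ * b ^ J) ^ 2 ≤ ‖W ω‖ ^ 2} :=
    fun ω (hω : δ * b ^ J ≤ ‖W ω‖) => pow_le_pow_left₀ (by positivity) hω 2
  refine (measure_mono hset).trans ?_
  rw [← ofReal_measureReal]
  refine ENNReal.ofReal_le_ofReal ?_
  have hpos : 0 < (δ * b ^ J) ^ 2 := by positivity
  refine le_of_mul_le_mul_left (hcheb.trans (hmax.trans ?_)) hpos
  calc 4 ^ (e + 1) * ∑ a ∈ I, ∫ ω, Z a ω ^ 2 ∂P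
      ≤ 4 ^ (e + 1) * (2 ^ J * 2 ^ (e + 1) * v) := by gcongr
    _ = _ := by
        have : (8 : ℝ) ^ (e + 1) = 4 ^ (e + 1) * 2 ^ (e + 1) := by rw [← mul_pow]; norm_num
        rw [this, div_pow, ← pow_mul, mul_pow, ← pow_mul, mul_comm 2 J]
        field_simp

/-- Borel-Cantelli over dyadic blocks: the finitely many bad blocks go into C, and in a good block
with J = ∑ j i the bound δ b^J is at most δ|n|^(1/β). -/
theorem ae_exists_abs_sum_truncAt_sub_le (hb : 1 < b) (hb2 : 2 < b ^ 2) (hbβ : b ^ β = 2)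
    (hβ : 0 < β) (hmom : Integrable (fun x => |x| ^ β * RenewalSets.logE |x| ^ e) ν)
    (hYm : ∀ m, Measurable (Y m)) (hY : ∀ m, P.map (Y m) = ν) (hind : iIndepFun Y P)
    {δ : ℝ} (hδ : 0 < δ) :
    ∀ᵐ ω ∂P, ∃ C : ℝ, ∀ n : Fin (e + 1) → ℕ,
      |∑ m ∈ indexBox n, (truncAt b (dyadicOrder m) (Y m ω) -
        ∫ x, truncAt b (dyadicOrder m) x ∂ν)| ≤ δ * (∏ i, (n i : ℝ)) ^ (1 / β) + C := by
  have hb0 : 0 < b := by linarith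
  let Z : (Fin (e + 1) → ℕ) → Ω → ℝ := fun a ω =>
    truncAt b (dyadicOrder a) (Y a ω) - ∫ x, truncAt b (dyadicOrder a) x ∂ν
  -- Any common strict upper bound for the components of the n in block j would do; the sum is a
  -- convenient one.
  let K : (Fin (e + 1) → ℕ) → ℕ := fun j => ∑ i, 2 ^ (j i + 1)
  let W : ∀ j : Fin (e + 1) → ℕ, Ω → (Fin (e + 1) → Fin (K j)) → ℝ := fun j ω n =>
    ∑ a ∈ indexBox (fun i => 2 ^ (j i + 1) - 1) with ∀ i, a i < (n i : ℕ), Z a ω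
  have hfin : ∑' j, P {ω | δ * b ^ (∑ i, j i) ≤ ‖W j ω‖} ≠ ⊤ := by
    let f : ℕ → ENNReal := fun k => ENNReal.ofReal (8 ^ (e + 1) / δ ^ 2 * ((2 / b ^ 2) ^ k *
      ∫ x, truncAt b k x ^ 2 ∂ν))
    refine ne_top_of_le_ne_top ?_ ((ENNReal.tsum_le_tsum fun j =>
      measure_boxSum_truncAt_ge_le hb hYm hY hind hδ j (K j)).trans (tsum_sum_fin_le e f))
    have heq : ∀ k : ℕ, ((k : ENNReal) + 1) ^ e * f k = ENNReal.ofReal (8 ^ (e + 1) / δ ^ 2) *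
        ∫⁻ x, ENNReal.ofReal ({x : ℝ | |x| < b ^ k}.indicator
          (fun x => ((k : ℝ) + 1) ^ e * (2 / b ^ 2) ^ k * x ^ 2) x) ∂ν := by
      intro k
      have h1 : (fun x => {x : ℝ | |x| < b ^ k}.indicator
          (fun x => ((k : ℝ) + 1) ^ e * (2 / b ^ 2) ^ k * x ^ 2) x) = fun x =>
          ((k : ℝ) + 1) ^ e * (2 / b ^ 2) ^ k * truncAt b k x ^ 2 := by
        ext x
        by_cases hx : |x| < b ^ k <;> simp [truncAt, Set.indicator, hx]
      rw [← ofReal_integral_eq_lintegral_ofReal, h1, integral_const_mul]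
      · simp only [f]
        rw [← ENNReal.ofReal_natCast, ← ENNReal.ofReal_one, ← ENNReal.ofReal_add (by positivity)
          zero_le_one, ← ENNReal.ofReal_pow (by positivity), ← ENNReal.ofReal_mul (by positivity),
          ← ENNReal.ofReal_mul (by positivity)]
        congr 1
        ring
      · refine Integrable.congr ?_ (.of_forall fun x => (congrFun h1 x).symm)
        exact (memLp_truncAt k hb0 2).integrable_sq.const_mul _
      · exact .of_forall fun x => Set.indicator_nonneg (fun _ _ => by positivity) x
    simp only [heq]
    rw [ENNReal.tsum_mul_left]
    exact ENNReal.mul_ne_top ENNReal.ofReal_ne_top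
      (tsum_lintegral_truncated_sq_ne_top hb hb2 hbβ hβ hmom)
  filter_upwards [ae_finite_setOfPred_mem hfin] with ω hω
  refine ⟨∑ j ∈ hω.toFinset, ‖W j ω‖, fun n => ?_⟩
  have hC0 : 0 ≤ ∑ j ∈ hω.toFinset, ‖W j ω‖ := Finset.sum_nonneg fun _ _ => norm_nonneg _
  have hN0 : 0 ≤ δ * (∏ i, (n i : ℝ)) ^ (1 / β) := by positivity
  by_cases hn : ∀ i, n i ≠ 0
  · let j : Fin (e + 1) → ℕ := fun i => Nat.log 2 (n i)
    have hnlt : ∀ i, n i < 2 ^ (j i + 1) := fun i => Nat.lt_pow_succ_log_self Nat.one_lt_two _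
    have hnK : ∀ i, n i < K j := fun i => (hnlt i).trans_le
      (Finset.single_le_sum (f := fun i => 2 ^ (j i + 1)) (fun _ _ => Nat.zero_le _)
        (Finset.mem_univ i))
    have hbox : ∑ m ∈ indexBox n, Z m ω = W j ω fun i => ⟨n i, hnK i⟩ := by
      refine Finset.sum_congr ?_ fun _ _ => rfl
      ext a
      simp only [Finset.mem_filter, mem_indexBox]
      refine ⟨fun h => ⟨fun i => ?_, h⟩, fun h => h.2⟩
      have := h i
      have := hnlt i
      omega
    have hle : |∑ m ∈ indexBox n, Z m ω| ≤ ‖W j ω‖ := by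
      rw [hbox]; exact norm_le_pi_norm (W j ω) _
    refine hle.trans ?_
    by_cases hj : δ * b ^ (∑ i, j i) ≤ ‖W j ω‖
    · have := Finset.single_le_sum (f := fun j => ‖W j ω‖) (fun _ _ => norm_nonneg _)
        (hω.mem_toFinset.2 hj)
      linarith
    · have h2 : 2 ^ (∑ i, j i) ≤ ∏ i, n i := by
        rw [← Finset.prod_pow_eq_pow_sum]
        exact Finset.prod_le_prod' fun i _ => Nat.pow_log_le_self 2 (hn i)
      have h3 : b ^ (∑ i, j i) ≤ (∏ i, (n i : ℝ)) ^ (1 / β) :=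
        pow_le_rpow_one_div hb0 hbβ hβ (by exact_mod_cast h2)
      have h4 := mul_le_mul_of_nonneg_left h3 hδ.le
      linarith [not_le.1 hj]
  · push Not at hn
    obtain ⟨i, hi⟩ := hn
    have : indexBox n = ∅ := by
      refine Finset.eq_empty_of_forall_notMem fun m hm => ?_
      have := mem_indexBox.1 hm i
      omega
    rw [this, Finset.sum_empty, abs_zero]
    positivity

/-- The Marcinkiewicz-Zygmund strong law for multi-indexed sums. -/
theorem ae_exists_abs_sum_indexBox_sub_le (hβ1 : 1 ≤ β) (hβ2 : β < 2)
    (hν : Integrable (fun x => x) ν)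
    (hmom : Integrable (fun x => |x| ^ β * RenewalSets.logE |x| ^ e) ν)
    (hYm : ∀ m, Measurable (Y m)) (hY : ∀ m, P.map (Y m) = ν) (hind : iIndepFun Y P)
    {δ : ℝ} (hδ : 0 < δ) :
    ∀ᵐ ω ∂P, ∃ C : ℝ, ∀ n : Fin (e + 1) → ℕ,
      |∑ m ∈ indexBox n, Y m ω - (∫ x, x ∂ν) * ∏ i, (n i : ℝ)| ≤
        δ * (∏ i, (n i : ℝ)) ^ (1 / β) + C := by
  have hβ : 0 < β := by linarith
  obtain ⟨b, hb, hb2, hbβ⟩ : ∃ b : ℝ, 1 < b ∧ 2 < b ^ 2 ∧ b ^ β = 2 := by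
    refine ⟨2 ^ (1 / β), Real.one_lt_rpow one_lt_two (by positivity), ?_, ?_⟩
    · rw [← Real.rpow_natCast, ← Real.rpow_mul zero_le_two]
      calc (2 : ℝ) = 2 ^ (1 : ℝ) := (Real.rpow_one 2).symm
        _ < _ := Real.rpow_lt_rpow_of_exponent_lt one_lt_two (by
            push_cast; rw [one_div, inv_mul_eq_div, lt_div_iff₀ hβ]; linarith)
    · rw [← Real.rpow_mul zero_le_two, one_div, inv_mul_cancel₀ hβ.ne', Real.rpow_one]
  obtain ⟨C₁, h₁⟩ := exists_abs_sum_integral_truncAt_sub_le hb hbβ hβ1 hν hmom (half_pos hδ)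
  filter_upwards [ae_exists_abs_sum_sub_truncAt_le hb hbβ hβ hmom hYm hY,
    ae_exists_abs_sum_truncAt_sub_le hb hb2 hbβ hβ hmom hYm hY hind (half_pos hδ)]
    with ω ⟨C₂, h₂⟩ ⟨C₃, h₃⟩
  refine ⟨C₁ + C₂ + C₃, fun n => ?_⟩
  have heq : ∑ m ∈ indexBox n, Y m ω - (∫ x, x ∂ν) * ∏ i, (n i : ℝ) =
      ∑ m ∈ indexBox n, (Y m ω - truncAt b (dyadicOrder m) (Y m ω)) +
      ∑ m ∈ indexBox n, (truncAt b (dyadicOrder m) (Y m ω) -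
        ∫ x, truncAt b (dyadicOrder m) x ∂ν) +
      ∑ m ∈ indexBox n, (∫ x, truncAt b (dyadicOrder m) x ∂ν - ∫ x, x ∂ν) := by
    rw [← Finset.sum_add_distrib, ← Finset.sum_add_distrib]
    have : ∀ m : Fin (e + 1) → ℕ, Y m ω - truncAt b (dyadicOrder m) (Y m ω) +
        (truncAt b (dyadicOrder m) (Y m ω) - ∫ x, truncAt b (dyadicOrder m) x ∂ν) +
        (∫ x, truncAt b (dyadicOrder m) x ∂ν - ∫ x, x ∂ν) = Y m ω - ∫ x, x ∂ν := fun m => by ring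
    simp only [this]
    rw [Finset.sum_sub_distrib, Finset.sum_const, card_indexBox, nsmul_eq_mul, mul_comm]
    push_cast
    rfl
  rw [heq]
  have := h₁ n
  have := h₂ n
  have := h₃ n
  refine (abs_add_three _ _ _).trans ?_
  linarith

end StrongLaw

/-! ### From lattice sums to renewal sets. -/

namespace RenewalSets

theorem multiSum_eq_sum_indexBox {d : ℕ} (a : (Fin d → ℕ+) → ℝ) (n : Fin d → ℕ) :
    multiSum a n = ∑ m ∈ indexBox n, a fun i => (m i).succPNat := by
  unfold multiSum
  split_ifs with h
  · symm
    refine Finset.sum_nbij' (fun m i => (m i).succPNat) (fun m i => (m i).natPred) ?_ ?_ ?_ ?_ ?_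
    · intro m hm
      rw [Finset.mem_Iic]
      intro i
      rw [← PNat.coe_le_coe]
      have h3 : ((n i).toPNat (h i) : ℕ) = n i := rfl
      rw [Nat.succPNat_coe, h3]
      exact mem_indexBox.1 hm i
    · intro m hm
      rw [mem_indexBox]
      intro i
      have h1 := PNat.coe_le_coe _ _ |>.2 (Finset.mem_Iic.1 hm i)
      have h2 := PNat.natPred_add_one (m i)
      have h3 : ((n i).toPNat (h i) : ℕ) = n i := rfl
      omega
    · intro m _; ext i; simp
    · intro m _; ext i; simp
    · intro m _; rfl
  · push Not at h
    obtain ⟨i, hi⟩ := h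
    rw [Finset.sum_eq_zero]
    intro m hm
    have := mem_indexBox.1 hm i
    omega

/-- The interpolation weights are products over the coordinates, so interpolating a product function
factors into one-dimensional linear interpolations. -/
theorem sum_boxVolume_mul_prod {d : ℕ} {x : Fin d → ℝ} (hx : 0 ≤ x) (g : ℕ → ℝ) :
    ∑ k ∈ cubeVertices x, boxVolume x k * ∏ i, g (oppositeVertex x k i) =
      ∏ i, ((x i - lowerCorner x i) * g (lowerCorner x i + 1) +
        (lowerCorner x i + 1 - x i) * g (lowerCorner x i)) := by
  have h1 : cubeVertices x =
      Fintype.piFinset fun i => Finset.Icc (lowerCorner x i) (lowerCorner x i + 1) := rfl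
  simp only [h1, boxVolume, oppositeVertex, ← Finset.prod_mul_distrib]
  rw [← Finset.prod_univ_sum (fun i => Finset.Icc (lowerCorner x i) (lowerCorner x i + 1))
    fun i k => |x i - (k : ℝ)| * g (2 * lowerCorner x i + 1 - k)]
  refine Finset.prod_congr rfl fun i _ => ?_
  have h2 : (lowerCorner x i : ℝ) ≤ x i := Nat.floor_le (hx i)
  have h3 : x i < lowerCorner x i + 1 := Nat.lt_floor_add_one _
  have h4 : Finset.Icc (lowerCorner x i) (lowerCorner x i + 1) =
      {lowerCorner x i, lowerCorner x i + 1} := by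
    ext k; simp; omega
  rw [h4, Finset.sum_pair (by omega), abs_of_nonneg (sub_nonneg.2 h2), abs_of_nonpos]
  · have e1 : 2 * lowerCorner x i + 1 - lowerCorner x i = lowerCorner x i + 1 := by omega
    have e2 : 2 * lowerCorner x i + 1 - (lowerCorner x i + 1) = lowerCorner x i := by omega
    rw [e1, e2]
    push_cast
    ring
  · push_cast; linarith

theorem interpolate_rpow_le {x α : ℝ} (hx : 0 ≤ x) (hα0 : 0 ≤ α) (hα1 : α ≤ 1) :
    (x - ⌊x⌋₊) * ((⌊x⌋₊ + 1 : ℕ) : ℝ) ^ α + (⌊x⌋₊ + 1 - x) * (⌊x⌋₊ : ℝ) ^ α ≤ x ^ α := by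
  have h2 : (⌊x⌋₊ : ℝ) ≤ x := Nat.floor_le hx
  have h3 : x < ⌊x⌋₊ + 1 := Nat.lt_floor_add_one _
  have h := (Real.concaveOn_rpow hα0 hα1).2 (x := ((⌊x⌋₊ + 1 : ℕ) : ℝ)) (y := (⌊x⌋₊ : ℝ))
    (Set.mem_Ici.2 (Nat.cast_nonneg _)) (Set.mem_Ici.2 (Nat.cast_nonneg _))
    (sub_nonneg.2 h2) (sub_nonneg.2 h3.le) (by ring)
  simp only [smul_eq_mul] at h
  refine h.trans (le_of_eq ?_)
  congr 1
  push_cast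
  ring

/-- The weights are nonnegative with sum 1, reproduce ∏ x i exactly, and by coordinatewise concavity
do not increase its power α; hence δ and C survive unchanged. -/
theorem abs_interpSum_sub_le {d : ℕ} {a : (Fin d → ℕ+) → ℝ} {μ δ α C : ℝ} (hδ : 0 ≤ δ)
    (hα0 : 0 ≤ α) (hα1 : α ≤ 1)
    (h : ∀ n : Fin d → ℕ, |multiSum a n - μ * ∏ i, (n i : ℝ)| ≤ δ * (∏ i, (n i : ℝ)) ^ α + C)
    {x : Fin d → ℝ} (hx : 0 ≤ x) :
    |interpSum a x - μ * ∏ i, x i| ≤ δ * (∏ i, x i) ^ α + C := by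
  have hv : ∀ k, 0 ≤ boxVolume x k := fun k => Finset.prod_nonneg fun _ _ => abs_nonneg _
  have hid : ∑ k ∈ cubeVertices x, boxVolume x k * ∏ i, (oppositeVertex x k i : ℝ) =
      ∏ i, x i := by
    rw [sum_boxVolume_mul_prod hx fun k => (k : ℝ)]
    refine Finset.prod_congr rfl fun i _ => ?_
    push_cast
    ring
  have hone : ∑ k ∈ cubeVertices x, boxVolume x k = 1 := by
    have := sum_boxVolume_mul_prod hx fun _ => (1 : ℝ)
    simpa using this
  have hpow : ∑ k ∈ cubeVertices x, boxVolume x k * (∏ i, (oppositeVertex x k i : ℝ)) ^ α ≤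
      (∏ i, x i) ^ α := by
    have h1 : ∀ k : Fin d → ℕ, (∏ i, (k i : ℝ)) ^ α = ∏ i, (k i : ℝ) ^ α := fun k =>
      (Real.finsetProd_rpow _ _ (fun _ _ => Nat.cast_nonneg _) _).symm
    simp only [h1]
    rw [sum_boxVolume_mul_prod hx fun k => (k : ℝ) ^ α,
      ← Real.finsetProd_rpow _ _ (fun i _ => hx i) _]
    refine Finset.prod_le_prod (fun i _ => ?_) fun i _ => interpolate_rpow_le (hx i) hα0 hα1
    have h2 : (lowerCorner x i : ℝ) ≤ x i := Nat.floor_le (hx i)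
    have h3 : x i < lowerCorner x i + 1 := Nat.lt_floor_add_one _
    have := sub_nonneg.2 h2
    have := sub_nonneg.2 h3.le
    positivity
  calc |interpSum a x - μ * ∏ i, x i|
      = |∑ k ∈ cubeVertices x, boxVolume x k *
          (multiSum a (oppositeVertex x k) - μ * ∏ i, (oppositeVertex x k i : ℝ))| := by
        rw [← hid, interpSum, Finset.mul_sum, ← Finset.sum_sub_distrib]
        congr 1
        exact Finset.sum_congr rfl fun k _ => by ring
    _ ≤ ∑ k ∈ cubeVertices x, boxVolume x k *
          (δ * (∏ i, (oppositeVertex x k i : ℝ)) ^ α + C) := by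
        refine (Finset.abs_sum_le_sum_abs _ _).trans (Finset.sum_le_sum fun k _ => ?_)
        rw [abs_mul, abs_of_nonneg (hv k)]
        exact mul_le_mul_of_nonneg_left (h _) (hv k)
    _ = δ * ∑ k ∈ cubeVertices x, boxVolume x k * (∏ i, (oppositeVertex x k i : ℝ)) ^ α + C := by
        rw [Finset.mul_sum]
        simp only [mul_add, Finset.sum_add_distrib, ← Finset.sum_mul, hone, one_mul]
        congr 1
        exact Finset.sum_congr rfl fun k _ => by ring
    _ ≤ _ := by gcongr

theorem mem_smul_renewalSet {d : ℕ} (a : (Fin d → ℕ+) → ℝ) {t : ℝ} (ht : 0 < t)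
    (x : Fin d → ℝ) :
    x ∈ (t ^ (-1 / (d : ℝ))) • renewalSet a t ↔
      0 ≤ x ∧ t ≤ interpSum a ((t ^ (1 / (d : ℝ))) • x) := by
  have hs : 0 < t ^ (1 / (d : ℝ)) := Real.rpow_pos_of_pos ht _
  have hinv : (t ^ (-1 / (d : ℝ)))⁻¹ = t ^ (1 / (d : ℝ)) := by
    rw [← Real.rpow_neg ht.le]; congr 1; ring
  rw [Set.mem_smul_set_iff_inv_smul_mem₀ (Real.rpow_pos_of_pos ht _).ne', hinv]
  change 0 ≤ _ ∧ _ ↔ _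
  refine and_congr_left fun _ => ⟨fun h i => ?_, fun h => smul_nonneg hs.le h⟩
  exact nonneg_of_mul_nonneg_right (h i) hs

theorem eventually_hypSet_subset_smul_renewalSet {d : ℕ} (hd : 1 ≤ d) {a : (Fin d → ℕ+) → ℝ}
    {μ β ε : ℝ} (hμ : 0 < μ) (hβ : 1 ≤ β) (hε : 0 < ε)
    (h : ∀ δ : ℝ, 0 < δ → ∃ C : ℝ, ∀ x : Fin d → ℝ, 0 ≤ x →
      |interpSum a x - μ * ∏ i, x i| ≤ δ * (∏ i, x i) ^ (1 / β) + C) :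
    ∀ᶠ t : ℝ in atTop,
      hypSet d μ (ε * t ^ (-1 + 1 / β)) ⊆ (t ^ (-1 / (d : ℝ))) • renewalSet a t ∧
      (t ^ (-1 / (d : ℝ))) • renewalSet a t ⊆ hypSet d μ (-(ε * t ^ (-1 + 1 / β))) := by
  have hβ0 : 0 < β := by linarith
  have hα0 : 0 < 1 / β := by positivity
  have hα1 : 1 / β ≤ 1 := by rwa [div_le_one hβ0]
  generalize 1 / β = α at *
  set A := (μ⁻¹ + ε) ^ α with hA
  have hA0 : 0 < A := by positivity
  -- Half of the available gain με t^α pays for the error at the threshold, as δ A ≤ με/2; the other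
  -- half absorbs C for large t. The bound δ ≤ μ serves points far inside H.
  obtain ⟨C, hC⟩ := h (min μ (μ * ε / (2 * A))) (by positivity)
  set δ := min μ (μ * ε / (2 * A)) with hδ
  have hδ0 : 0 < δ := by positivity
  have hδμ : δ ≤ μ := min_le_left _ _
  have hδA : δ * A ≤ μ * ε / 2 := by
    calc δ * A ≤ μ * ε / (2 * A) * A := by gcongr; exact min_le_right _ _
      _ = μ * ε / 2 := by field_simp
  filter_upwards [eventually_ge_atTop 1, eventually_ge_atTop μ,
    (tendsto_rpow_atTop hα0).eventually (eventually_ge_atTop (C / (μ * ε / 2)))] with t ht1 htμ htC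
  have ht : 0 < t := by linarith
  have hCt : C ≤ μ * ε / 2 * t ^ α := by
    rw [div_le_iff₀ (by positivity)] at htC
    linarith
  have htα : 0 < t ^ α := Real.rpow_pos_of_pos ht _
  have hte : t * t ^ (-1 + α) = t ^ α := by
    rw [Real.rpow_add ht, Real.rpow_neg_one, ← mul_assoc, mul_inv_cancel₀ ht.ne', one_mul]
  have htα1 : t ^ α ≤ t := by
    calc t ^ α ≤ t ^ (1 : ℝ) := Real.rpow_le_rpow_of_exponent_le ht1 hα1
      _ = t := Real.rpow_one t
  have hprod : ∀ x : Fin d → ℝ, ∏ i, ((t ^ (1 / (d : ℝ))) • x) i = t * ∏ i, x i := by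
    intro x
    simp only [Pi.smul_apply, smul_eq_mul, Finset.prod_mul_distrib, Finset.prod_const,
      Finset.card_univ, Fintype.card_fin]
    rw [← Real.rpow_natCast, ← Real.rpow_mul ht.le, one_div, inv_mul_cancel₀, Real.rpow_one]
    have : 0 < d := hd
    positivity
  have hbound : ∀ x : Fin d → ℝ, 0 ≤ x →
      |interpSum a ((t ^ (1 / (d : ℝ))) • x) - μ * (t * ∏ i, x i)| ≤
        δ * (t * ∏ i, x i) ^ α + C := by
    intro x hx
    rw [← hprod]
    exact hC _ (smul_nonneg (Real.rpow_nonneg ht.le _) hx)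
  constructor
  · rintro x ⟨hx, hxp⟩
    rw [mem_smul_renewalSet a ht]
    refine ⟨hx, ?_⟩
    have hb := (abs_le.1 (hbound x hx)).1
    set v := t * ∏ i, x i with hv
    -- The value of v on the boundary of H; here w^α ≤ A t^α, and t ≥ μ makes w ≥ 1.
    set w := t * μ⁻¹ + ε * t ^ α with hw
    have hwv : w ≤ v := by
      calc w = t * (μ⁻¹ + ε * t ^ (-1 + α)) := by rw [hw, ← hte]; ring
        _ ≤ v := mul_le_mul_of_nonneg_left hxp ht.le
    have hw1 : 1 ≤ w := by
      have : 1 ≤ t * μ⁻¹ := by rwa [← div_eq_mul_inv, one_le_div hμ]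
      have : 0 < ε * t ^ α := by positivity
      linarith
    have hw0 : 0 < w := by linarith
    have hwA : w ^ α ≤ A * t ^ α := by
      rw [hA, ← Real.mul_rpow (by positivity) ht.le]
      refine Real.rpow_le_rpow hw0.le ?_ hα0.le
      rw [hw]
      nlinarith
    -- Beyond 1 a power α ≤ 1 grows no faster than the identity. The error therefore grows by at
    -- most δ(v - w) ≤ μ(v - w), which the main term μv compensates however large v is.
    have hvw : v ^ α ≤ w ^ α + (v - w) := by
      have h1 : (v / w) ^ α ≤ v / w := by
        calc (v / w) ^ α ≤ (v / w) ^ (1 : ℝ) :=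
              Real.rpow_le_rpow_of_exponent_le ((one_le_div hw0).2 hwv) hα1
          _ = v / w := Real.rpow_one _
      have h2 : w ^ α ≤ w := by
        calc w ^ α ≤ w ^ (1 : ℝ) := Real.rpow_le_rpow_of_exponent_le hw1 hα1
          _ = w := Real.rpow_one _
      have h3 : v ^ α = w ^ α * (v / w) ^ α := by
        rw [← Real.mul_rpow hw0.le (div_nonneg (hw0.le.trans hwv) hw0.le),
          mul_div_cancel₀ _ hw0.ne']
      have h4 : 0 ≤ v / w - 1 := sub_nonneg.2 ((one_le_div hw0).2 hwv)
      calc v ^ α ≤ w ^ α * (v / w) := by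
            rw [h3]
            exact mul_le_mul_of_nonneg_left h1 (Real.rpow_nonneg hw0.le _)
        _ = w ^ α + w ^ α * (v / w - 1) := by ring
        _ ≤ w ^ α + w * (v / w - 1) := by gcongr
        _ = w ^ α + (v - w) := by rw [mul_sub, mul_div_cancel₀ _ hw0.ne', mul_one]
    have h5 : δ * v ^ α ≤ δ * (A * t ^ α) + μ * (v - w) := by
      calc δ * v ^ α ≤ δ * (A * t ^ α + (v - w)) := by gcongr; linarith
        _ = δ * (A * t ^ α) + δ * (v - w) := by ring
        _ ≤ _ := by
            have := mul_le_mul_of_nonneg_right hδμ (sub_nonneg.2 hwv)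
            linarith
    have h6 : δ * (A * t ^ α) ≤ μ * ε / 2 * t ^ α := by
      rw [← mul_assoc]; gcongr
    have h7 : μ * w = t + μ * ε * t ^ α := by
      rw [hw]; field_simp
    linarith
  · intro x hxM
    obtain ⟨hx, hxt⟩ := (mem_smul_renewalSet a ht x).1 hxM
    refine ⟨hx, ?_⟩
    by_contra! hlt
    have hb := (abs_le.1 (hbound x hx)).2
    have hx0 : 0 ≤ ∏ i, x i := Finset.prod_nonneg fun i _ => hx i
    set v := t * ∏ i, x i with hv
    have hv0 : 0 ≤ v := by positivity
    have hlt' : v < t * μ⁻¹ - ε * t ^ α := by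
      calc v < t * (μ⁻¹ + -(ε * t ^ (-1 + α))) := mul_lt_mul_of_pos_left hlt ht
        _ = t * μ⁻¹ - ε * t ^ α := by rw [← hte]; ring
    have hvA : v ^ α ≤ A * t ^ α := by
      rw [hA, ← Real.mul_rpow (by positivity) ht.le]
      refine Real.rpow_le_rpow hv0 ?_ hα0.le
      have : 0 < ε * t ^ α := by positivity
      have : 0 < ε * t := by positivity
      linarith
    have h6 : δ * v ^ α ≤ μ * ε / 2 * t ^ α := by
      calc δ * v ^ α ≤ δ * (A * t ^ α) := by gcongr
        _ ≤ _ := by rw [← mul_assoc]; gcongr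
    have h7 : μ * v < t - μ * ε * t ^ α := by
      calc μ * v < μ * (t * μ⁻¹ - ε * t ^ α) := by gcongr
        _ = _ := by field_simp
    linarith

theorem measurable_logE : Measurable logE :=
  Measurable.ite (measurableSet_lt measurable_id measurable_const) measurable_const
    Real.measurable_log

end RenewalSets

/-! ### Assembly. -/

theorem corollary1 {d : ℕ} (hd : 1 ≤ d)
    {Ω₀ : Type*} [MeasurableSpace Ω₀] (P₀ : Measure Ω₀) [IsProbabilityMeasure P₀]
    {Ω : Type*} [MeasurableSpace Ω] (P : Measure Ω) [IsProbabilityMeasure P]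
    -- the generic summand, integrable with a positive mean
    (ξ : Ω₀ → ℝ) (hint : Integrable ξ P₀) (hμ : 0 < ∫ ω, ξ ω ∂P₀)
    -- its independent copies, indexed by the positive multi-indices
    (X : (Fin d → ℕ+) → Ω → ℝ) (hindep : iIndepFun X P)
    (hcopy : ∀ m, IdentDistrib (X m) ξ P P₀)
    -- the moment condition
    (β : ℝ) (hβ₁ : 1 ≤ β) (hβ₂ : β < 2)
    (hmom : Integrable (fun ω => |ξ ω| ^ β * RenewalSets.logE |ξ ω| ^ (d - 1)) P₀) :
    ∀ ε : ℝ, 0 < ε → ∀ᵐ ω ∂P, ∀ᶠ t : ℝ in atTop,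
      RenewalSets.hypSet d (∫ ω', ξ ω' ∂P₀) (ε * t ^ (-1 + 1 / β)) ⊆
          (t ^ (-1 / (d : ℝ))) • RenewalSets.renewalSet (fun m => X m ω) t ∧
        (t ^ (-1 / (d : ℝ))) • RenewalSets.renewalSet (fun m => X m ω) t ⊆
          RenewalSets.hypSet d (∫ ω', ξ ω' ∂P₀) (-(ε * t ^ (-1 + 1 / β))) := by
  intro ε hε
  obtain ⟨e, rfl⟩ : ∃ e, d = e + 1 := ⟨d - 1, by omega⟩
  have hβ0 : 0 < β := by linarith
  have hα1 : 1 / β ≤ 1 := by rwa [div_le_one hβ0]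
  have hξ : AEMeasurable ξ P₀ := hint.aemeasurable
  set ν := P₀.map ξ with hνdef
  have : IsProbabilityMeasure ν := Measure.isProbabilityMeasure_map hξ
  have hmean : ∫ x, x ∂ν = ∫ ω', ξ ω' ∂P₀ :=
    integral_map (f := fun x : ℝ => x) hξ aestronglyMeasurable_id
  have hν : Integrable (fun x => x) ν :=
    (integrable_map_measure (g := fun x : ℝ => x) aestronglyMeasurable_id hξ).2 hint
  have hνmom : Integrable (fun x => |x| ^ β * RenewalSets.logE |x| ^ e) ν := by
    refine (integrable_map_measure (Measurable.aestronglyMeasurable ?_) hξ).2 hmom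
    exact (measurable_id.abs.pow_const β).mul
      ((RenewalSets.measurable_logE.comp measurable_id.abs).pow_const e)
  have hXm : ∀ m, AEMeasurable (X m) P := fun m => (hcopy m).aemeasurable_fst
  -- The copies are only almost everywhere measurable; measurable versions agree with them
  -- simultaneously off one null set, the index set being countable.
  let X' : (Fin (e + 1) → ℕ+) → Ω → ℝ := fun m => (hXm m).mk (X m)
  have hXX' : ∀ m, X m =ᵐ[P] X' m := fun m => (hXm m).ae_eq_mk
  let φ : (Fin (e + 1) → ℕ) → (Fin (e + 1) → ℕ+) := fun m i => (m i).succPNat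
  have hφ : Function.Injective φ := fun m n h => funext fun i =>
    Nat.succPNat_injective (congrFun h i)
  have hind : iIndepFun (fun m => X' (φ m)) P := ((iIndepFun_congr hXX').1 hindep).precomp hφ
  have hYm : ∀ m, Measurable (X' (φ m)) := fun m => (hXm _).measurable_mk
  have hY : ∀ m, P.map (X' (φ m)) = ν := fun m => by
    rw [← Measure.map_congr (hXX' _), (hcopy _).map_eq]
  -- The exceptional set depends on δ, so δ runs through 1/(q+1) to give a single null set for all δ
  -- > 0.
  have hlaw : ∀ q : ℕ, ∀ᵐ ω ∂P, ∃ C : ℝ, ∀ n : Fin (e + 1) → ℕ,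
      |∑ m ∈ indexBox n, X' (φ m) ω - (∫ x, x ∂ν) * ∏ i, (n i : ℝ)| ≤
        1 / ((q : ℝ) + 1) * (∏ i, (n i : ℝ)) ^ (1 / β) + C := fun q =>
    ae_exists_abs_sum_indexBox_sub_le hβ₁ hβ₂ hν hνmom hYm hY hind (by positivity)
  filter_upwards [ae_all_iff.2 hlaw, ae_all_iff.2 hXX'] with ω hω hXω
  refine RenewalSets.eventually_hypSet_subset_smul_renewalSet hd hμ hβ₁ hε fun δ hδ => ?_
  obtain ⟨q, hq⟩ := exists_nat_one_div_lt hδ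
  obtain ⟨C, hC⟩ := hω q
  refine ⟨C, fun x hx => RenewalSets.abs_interpSum_sub_le hδ.le (by positivity) hα1 (fun n => ?_) hx⟩
  rw [RenewalSets.multiSum_eq_sum_indexBox, ← hmean]
  simp only [hXω]
  refine (hC n).trans ?_
  gcongr
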